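/- **Setting.** Let $(X,d)$ be a compact metric space with a continuous flow $\varphi:X\times\mathbb R\to X$, $(x,t)\mapsto x\cdot t$. For a set $S\subset X$, the flow is *gradient-like in $S$* if there is a continuous $g:S\to\mathbb R$ with $g(x\cdot t)<g(x)$ whenever $t>0$, $x$ is not a fixed point and $x\cdot[0,t]\subset S$; it is *gradient-like* if it is gradient-like in $X$. Write $B_r(p)$ for the open ball and $\bar B_r(p)$ for its closure. A *cocycle* is a bounded function $\alpha:X\times X\to\mathbb R$ such that $\delta\alpha(x,y,z)=\alpha(y,z)-\alpha(x,z)+\alpha(x,y)$ vanishes in a neighbourhood of the diagonal of $X^3$. A *primitive* of $\alpha$ on $S\subset X$ is a bounded function $\beta:S\to\mathbb R$ such that $\beta(y)-\beta(x)=\alpha(x,y)$ for all $(x,y)$ in a neighbourhood in $S\times S$ of the diagonal. The cocycle is *trivial* if it has a primitive on $X$. The integral of $\alpha$ along a continuous curve $\gamma:[a,b]\to X$, $-\infty\le a\le b\le\infty$, is $$\int_\gamma\alpha=\sum_{j=0}^{k-1}\bigl(\beta_j(\gamma(t_{j+1}))-\beta_j(\gamma(t_j))\bigr),$$ where $a=t_0\le\dots\le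 t_k=b$ is a partition such that $\gamma([t_j,t_{j+1}])$ lies in an open ball on whose closure $\beta_j$ is a primitive of $\alpha$ (the value does not depend on the choices). The flow is an *$\alpha$-flow* if $\alpha$ is a cocycle, the flow has finitely many fixed points $p_1,\dots,p_n$ ($n\ge 0$), and there are $r,T_0,\rho>0$ and $0\le\lambda<1$ such that the sets $\bar B_r(p_i)$ are pairwise disjoint and, with $X_r=X\setminus\bigcup_iB_r(p_i)$: 1. the flow is gradient-like in each $\bar B_r(p_i)$; 2. on each $\bar B_r(p_i)$ there is a primitive $\beta$ of $\alpha$ with $|\beta(y)-\beta(x)|\le\lambda\rho$ for all $x,y\in\bar B_r(p_i)$; 3. $\int_\gamma\alpha\ge\rho$ for every orbit piece $\gamma$ in $X_r$, over a compact time interval $[a,b]$ with $a<b$, that is not part of a longer orbit piece in $X_r$; 4. $\int_{[x,x\cdot T_0]}\alpha\ge\rho$ for every $x$ with $x\cdot[0,\infty)\subset X_r$ or $x\cdot(-\infty,T_0]\subset X_r$. For $s>0$, an *$s$-covering* $\mathcal U(s)$ consists of finitely many open balls $B_1,\dots,B_l$ of radius $s$ covering $X$ and a primitive $\beta_j$ of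 $\alpha$ on each $\bar B_j$. It is *coherent* if for each $j$ the set $\bar B_j$ is connected or $\beta_j(y)-\beta_j(x)=\alpha(x,y)$ for all $x,y\in\bar B_j$. A $(\mathcal U(s),T)$-*chain* $\gamma$ consists of points $x_0,\dots,x_k$ ($k\ge1$), times $t_0,\dots,t_{k-1}\ge T$ and indices $i_j$ with $x_j\cdot t_j,\,x_{j+1}\in B_{i_j}$ for $0\le j<k$, and $$\int_\gamma\alpha=\sum_{j=0}^{k-1}\int_{[x_j,x_j\cdot t_j]}\alpha+\sum_{j=0}^{k-1}\bigl(\beta_{i_j}(x_{j+1})-\beta_{i_j}(x_j\cdot t_j)\bigr).$$ For a sequence $s_i>0$ with $s_i\to0$ and $s_i$-coverings $\mathcal U(s_i)$ consider the condition $(\ast)$ for all $M>0$, $T>0$ and every $i$ there is a $(\mathcal U(s_i),T)$-chain $\gamma_i$ with $\bigl|\int_{\gamma_i}\alpha\bigr|\ge M$. **Theorem.** Let the flow be an $\alpha$-flow on the compact metric space $(X,d)$ with a nontrivial cocycle $\alpha$. (a) The flow is not gradient-like if and only if $(\ast)$ holds for every sequence $s_i>0$ with $s_i\to0$ and all $s_i$-coverings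 $\mathcal U(s_i)$. (b) If $(\ast)$ holds for one sequence $s_i>0$ with $s_i\to 0$ and one choice of coherent $s_i$-coverings $\mathcal U(s_i)$, then the flow is not gradient-like. (c) If for every $M>0$ there is a trajectory $[x,x\cdot T]$, $T\ge0$, with $\bigl|\int_{[x,x\cdot T]}\alpha\bigr|\ge M$, then the flow is not gradient-like. (d) If there is a cycle of orbits joining fixed points, run through in the forward direction of the flow (orbits of $x_0,\dots,x_{k-1}$ and fixed points $q_0,\dots,q_k=q_0$ with $x_j\cdot t\to q_j$ as $t\to-\infty$ and $x_j\cdot t\to q_{j+1}$ as $t\to\infty$), such that the sum of the integrals of $\alpha$ along these orbits, completed by their limit points, is at least $1$ in absolute value, then the flow is not gradient-like. -/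

import Mathlib

open Set Filter Topology Metric

noncomputable section

namespace CocycleFlow

/-! ### Bounded Alexander–Spanier cochains with real coefficients, in degrees 0, 1, 2 -/

/-- `β` is a bounded primitive of `α` on the subspace `S`: it is bounded on `S`, and
`δβ - α`, where `δβ (x, y) = β y - β x`, vanishes on a neighbourhood in `S × S` of the diagonal
of `S`. In symbols, `δβ ≃ α` on `S`. -/
def IsPrimitiveOn {Y : Type*} [TopologicalSpace Y] (α : Y → Y → ℝ) (S : Set Y) (β : Y → ℝ) :
    Prop :=
  (∃ M : ℝ, ∀ x ∈ S, |β x| ≤ M) ∧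
    ∀ z ∈ S, ∀ᶠ q : Y × Y in 𝓝[S ×ˢ S] (z, z), β q.2 - β q.1 = α q.1 q.2

/-- `α` is a (bounded, real valued, Alexander–Spanier) 1-cocycle: it is bounded, and
`δα (x, y, z) = α (y, z) - α (x, z) + α (x, y)` vanishes on a neighbourhood of the diagonal. -/
def IsCocycle {Y : Type*} [TopologicalSpace Y] (α : Y → Y → ℝ) : Prop :=
  (∃ M : ℝ, ∀ x y, |α x y| ≤ M) ∧
    ∀ z, ∀ᶠ q : Y × Y × Y in 𝓝 (z, z, z),
      α q.2.1 q.2.2 - α q.1 q.2.2 + α q.1 q.2.1 = 0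

/-- `α` represents the zero class: `δβ ≃ α` for a bounded function `β` on the whole space. -/
def IsTrivial {Y : Type*} [TopologicalSpace Y] (α : Y → Y → ℝ) : Prop :=
  ∃ β : Y → ℝ, IsPrimitiveOn α univ β

variable {X : Type*} [MetricSpace X]

/-! ### Integration along curves -/

/-- `J` is a value of `∑ j, (β j (γ (t (j + 1))) - β j (γ (t j)))` for a partition
`a = t 0 ≤ t 1 ≤ ⋯ ≤ t n = b` such that `γ` maps `[t j, t (j + 1)]` into an open ball on the closure
of which `β j` is a bounded primitive of `α`. For a cocycle and a continuous curve there is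
exactly one such value. The parameter interval may lie in any ordered set; it lies in `ℝ` for
trajectories over compact time intervals, and is `[-∞, ∞]` for orbits completed by their
limit points. -/
def IsIntegralAlong {I : Type*} [Preorder I] (α : X → X → ℝ) (γ : I → X) (a b : I) (J : ℝ) :
    Prop :=
  ∃ (n : ℕ) (t : ℕ → I) (c : ℕ → X) (R : ℕ → ℝ) (β : ℕ → X → ℝ),
    t 0 = a ∧ t n = b ∧
    (∀ j < n, t j ≤ t (j + 1) ∧
      (∀ u ∈ Icc (t j) (t (j + 1)), γ u ∈ ball (c j) (R j)) ∧
      IsPrimitiveOn α (closure (ball (c j) (R j))) (β j)) ∧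
    J = ∑ j ∈ Finset.range n, (β j (γ (t (j + 1))) - β j (γ (t j)))

open Classical in
/-- The integral of the cocycle `α` along the curve `γ` from parameter `a` to parameter `b`. -/
def curveIntegral {I : Type*} [Preorder I] (α : X → X → ℝ) (γ : I → X) (a b : I) : ℝ :=
  if h : ∃ J : ℝ, IsIntegralAlong α γ a b J then h.choose else 0

/-- The integral of `α` along the trajectory `[x, x · T]`. -/
def orbitIntegral (φ : Flow ℝ X) (α : X → X → ℝ) (x : X) (T : ℝ) : ℝ :=
  curveIntegral α (fun t : ℝ => φ t x) 0 T

/-! ### Gradient-like flows and flows carrying a cocycle -/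

/-- `x` is a fixed point of the flow. -/
def IsFixedPoint (φ : Flow ℝ X) (x : X) : Prop :=
  ∀ t : ℝ, φ t x = x

/-- The flow is gradient-like in `S`: there is a continuous real function on `S` that is strictly
decreasing along the pieces in `S` of nonconstant solutions. -/
def GradientLikeOn (φ : Flow ℝ X) (S : Set X) : Prop :=
  ∃ g : X → ℝ, ContinuousOn g S ∧
    ∀ (x : X) (t : ℝ), 0 < t → ¬ IsFixedPoint φ x → (∀ u ∈ Icc 0 t, φ u x ∈ S) →
      g (φ t x) < g x

/-- The flow is gradient-like: it has a Lyapunov function on the whole space. -/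
def GradientLike (φ : Flow ℝ X) : Prop :=
  GradientLikeOn φ univ

/-- The space punctured by the open balls of radius `r` about the fixed points. -/
def punctured (φ : Flow ℝ X) (r : ℝ) : Set X :=
  {x | ∀ p, IsFixedPoint φ p → x ∉ ball p r}

/-- `[x, x · b]` with `b > 0` is a trajectory of the flow restricted to the punctured
space, i.e. it lies in the punctured space and no longer piece of the orbit around it does. -/
def IsCompactTrajectory (φ : Flow ℝ X) (r : ℝ) (x : X) (b : ℝ) : Prop :=
  0 < b ∧ (∀ t ∈ Icc 0 b, φ t x ∈ punctured φ r) ∧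
    ∀ a' b' : ℝ, a' ≤ 0 → b ≤ b' → (∀ t ∈ Icc a' b', φ t x ∈ punctured φ r) → a' = 0 ∧ b' = b

/-- The flow `φ` is an `α`-flow. -/
def IsAlphaFlow (φ : Flow ℝ X) (α : X → X → ℝ) : Prop :=
  IsCocycle α ∧ {p | IsFixedPoint φ p}.Finite ∧
  ∃ r T₀ ρ lam : ℝ, 0 < r ∧ 0 < T₀ ∧ 0 < ρ ∧ 0 ≤ lam ∧ lam < 1 ∧
    -- `r` is so small that the closed balls about the fixed points are disjoint
    (∀ p q, IsFixedPoint φ p → IsFixedPoint φ q → p ≠ q →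
      Disjoint (closure (ball p r)) (closure (ball q r))) ∧
    -- the flow is gradient-like near the fixed points
    (∀ p, IsFixedPoint φ p → GradientLikeOn φ (closure (ball p r))) ∧
    -- `α` is a coboundary near the fixed points, with small oscillation
    (∀ p, IsFixedPoint φ p → ∃ β : X → ℝ, IsPrimitiveOn α (closure (ball p r)) β ∧
      ∀ x ∈ closure (ball p r), ∀ y ∈ closure (ball p r), |β y - β x| ≤ lam * ρ) ∧
    -- trajectories of the punctured flow with a compact time interval
    (∀ (x : X) (b : ℝ), IsCompactTrajectory φ r x b → ρ ≤ orbitIntegral φ α x b) ∧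
    -- pieces of time length `T₀` of trajectories of the punctured flow with a time interval
    -- that is unbounded above or unbounded below
    (∀ x : X, ((∀ t : ℝ, 0 ≤ t → φ t x ∈ punctured φ r) ∨
        (∀ t : ℝ, t ≤ T₀ → φ t x ∈ punctured φ r)) → ρ ≤ orbitIntegral φ α x T₀)

/-! ### Coverings, chains, and integration along chains -/

/-- An `s`-covering `𝒰(s)` for `α`: finitely many open balls of radius `s` that cover `X`, with a
bounded primitive of `α` on the closure of each of them. -/
structure BallCovering (α : X → X → ℝ) (s : ℝ) where
  /-- the number of balls -/
  card : ℕ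
  /-- the centres of the balls -/
  center : Fin card → X
  cover : ∀ x : X, ∃ j, x ∈ ball (center j) s
  /-- the primitives of `α` on the closures of the balls -/
  prim : Fin card → X → ℝ
  isPrimitiveOn : ∀ j, IsPrimitiveOn α (closure (ball (center j) s)) (prim j)

/-- The increments of the primitives of the covering are not subject to an arbitrary choice: each
closed ball is connected (so that a primitive on it is unique up to a constant), or the primitive
chosen on it satisfies `δβ = α` on the whole closed ball, not only near the diagonal. -/
def BallCovering.IsCoherent {α : X → X → ℝ} {s : ℝ} (U : BallCovering α s) : Prop :=
  ∀ j, IsPreconnected (closure (ball (U.center j) s)) ∨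
    ∀ x ∈ closure (ball (U.center j) s), ∀ y ∈ closure (ball (U.center j) s),
      U.prim j y - U.prim j x = α x y

/-- A `(𝒰(s), T)`-chain `{x 0, …, x k | t 0, …, t (k - 1)}`, with `k ≥ 1`. -/
structure Chain (φ : Flow ℝ X) {α : X → X → ℝ} {s : ℝ} (U : BallCovering α s) (T : ℝ) where
  /-- the number of trajectories in the chain -/
  len : ℕ
  len_pos : 0 < len
  /-- the points of the chain -/
  pt : Fin (len + 1) → X
  /-- the times of the chain -/
  time : Fin len → ℝ
  le_time : ∀ j, T ≤ time j
  /-- the ball in which the chain jumps from `x j · t j` to `x (j + 1)` -/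
  idx : Fin len → Fin U.card
  left_mem : ∀ j, φ (time j) (pt j.castSucc) ∈ ball (U.center (idx j)) s
  right_mem : ∀ j, pt j.succ ∈ ball (U.center (idx j)) s

/-- The integral of `α` along a chain. -/
def Chain.integral {φ : Flow ℝ X} {α : X → X → ℝ} {s : ℝ} {U : BallCovering α s} {T : ℝ}
    (c : Chain φ U T) : ℝ :=
  ∑ j, orbitIntegral φ α (c.pt j.castSucc) (c.time j) +
    ∑ j, (U.prim (c.idx j) (c.pt j.succ) - U.prim (c.idx j) (φ (c.time j) (c.pt j.castSucc)))

/-- For every `M, T > 0` and every `i` there is a `(𝒰(s i), T)`-chain along which the integral of `α`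
is at least `M` in absolute value. -/
def HasLargeChains (φ : Flow ℝ X) {α : X → X → ℝ} {s : ℕ → ℝ}
    (U : (i : ℕ) → BallCovering α (s i)) : Prop :=
  ∀ M : ℝ, 0 < M → ∀ T : ℝ, 0 < T → ∀ i : ℕ, ∃ c : Chain φ (U i) T, M ≤ |c.integral|

/-! ### Cycles of orbits -/

/-- The orbit of `x`, completed by the values `p` at time `-∞` and `q` at time `∞`. -/
def completedOrbit (φ : Flow ℝ X) (x p q : X) (t : EReal) : X :=
  if t = ⊥ then p else if t = ⊤ then q else φ t.toReal x

/-- A cycle of orbits joining fixed points: for `j < len` the orbit of `x j` runs, in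
the forward direction of the flow, from the fixed point `p j` to the fixed point `p (j + 1)`, and
`p len = p 0`. -/
structure OrbitCycle (φ : Flow ℝ X) where
  /-- the number of orbits -/
  len : ℕ
  /-- the fixed points -/
  p : ℕ → X
  /-- points on the orbits -/
  x : ℕ → X
  fixed : ∀ j ≤ len, IsFixedPoint φ (p j)
  tendsto_atBot : ∀ j < len, Tendsto (fun t : ℝ => φ t (x j)) atBot (𝓝 (p j))
  tendsto_atTop : ∀ j < len, Tendsto (fun t : ℝ => φ t (x j)) atTop (𝓝 (p (j + 1)))
  closed : p len = p 0

/-- The integral of `α` along a cycle of orbits. -/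
def OrbitCycle.integral {φ : Flow ℝ X} (c : OrbitCycle φ) (α : X → X → ℝ) : ℝ :=
  ∑ j ∈ Finset.range c.len,
    curveIntegral α (completedOrbit φ (c.x j) (c.p j) (c.p (j + 1))) ⊥ ⊤

end CocycleFlow

end

open CocycleFlow

/-!
For a trajectory write `I (x, t)` for the integral of `α` along `[x, x · t]`. The cocycle identity
holds on all balls of some fixed radius, so `I` is additive in time and equals `α (x, x · t)` for
short times (`orbitIntegral_eq_sub`, `orbitIntegral_add`, `exists_orbitIntegral_eq`). The local data
of an `α`-flow are collected in `FixedPointNhd`: a neighbourhood `N` of the fixed points on whose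
closure `α` has a primitive `pot` with oscillation less than the integral `ρ` gained along every
trajectory that crosses the complement of `N`.

*A flow that is not gradient-like has large chains.* If, on the contrary, all chain integrals are
bounded, then closed chains with small jumps have integral zero, because they can be repeated. By
Conley's argument (`gradientLike_of_not_chainRecurrent`) it suffices that no point `x` that is not
fixed is chain recurrent for the time-`T` map. The Lyapunov function is built from the
barriers `chainBarrier`, which are continuous in the endpoint for free, and averaged over `[0, T]`.
Suppose such an `x` is recurrent. The chain class of `x` contains fixed points, since bounded
integrals force trajectories to settle down near fixed points (`exists_stay`). To each fixed point
`q` of the class assign the integral along chains from `x` to `q`, minus `pot q`. As chains lead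
from `q` to `x`, some orbit of the class emanates from `q` (`exists_leaving_orbit`); it
leaves `N`, and on its way to a fixed point of the class the value increases by at least the
difference of `ρ` and the oscillation of `pot` (`exists_stay_of_exit`). So no value is the largest,
which contradicts the finiteness of the set of fixed points (`not_chainsTo_self_of_bounded`).

*A gradient-like flow has no large chains*, for coherent coverings by small balls. Cut long
trajectories into pieces of time length between `1` and `2`. A piece, with the jump
after it, that starts close to a fixed point contributes exactly an increment of `pot`; coherence is
what makes this true for the jump. The number of the other pieces is bounded: finitely many
levels of the Lyapunov function, none of them its value at a fixed point, can be crossed only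
downwards if the jumps are small, and each such piece crosses one (`exists_counting_function`).
The statement about trajectories follows, since a long trajectory is a chain without jumps; the one
about cycles holds because the Lyapunov function decreases strictly along nonconstant orbits.
-/

namespace CocycleFlow

variable {X : Type*} [MetricSpace X]

/-! ### Uniformity on the compact phase space -/

theorem exists_uniform_of_eventually_diagonal [CompactSpace X] {P : X × X → Prop}
    (h : ∀ z, ∀ᶠ q in 𝓝 (z, z), P q) : ∃ δ > 0, ∀ x y, dist x y < δ → P (x, y) := by
  have h' : ∀ᶠ q in uniformity X, P q := by
    rw [compactSpace_uniformity, Filter.eventually_iSup]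
    exact h
  obtain ⟨δ, hδ, H⟩ := Metric.mem_uniformity_dist.1 h'
  exact ⟨δ, hδ, fun x y hxy => H hxy⟩

theorem exists_time_dist_lt [CompactSpace X] (φ : Flow ℝ X) {δ : ℝ} (hδ : 0 < δ) :
    ∃ η > 0, ∀ x u v, |u - v| ≤ η → dist (φ u x) (φ v x) < δ := by
  have h : ∀ᶠ t in 𝓝 (0 : ℝ), ∀ x ∈ (univ : Set X), dist (φ t x) x < δ := by
    refine isCompact_univ.eventually_forall_of_forall_eventually fun x _ => ?_
    have hc : ContinuousAt (fun q : ℝ × X => dist (φ q.1 q.2) q.2) (0, x) := by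
      exact ((φ.continuous continuous_fst continuous_snd).dist continuous_snd).continuousAt
    exact hc.eventually (gt_mem_nhds (by simpa using hδ))
  obtain ⟨η, hη, H⟩ := Metric.eventually_nhds_iff.1 h
  refine ⟨η / 2, by positivity, fun x u v huv => ?_⟩
  have h1 : φ u x = φ (u - v) (φ v x) := by rw [← φ.map_add]; simp
  rw [h1]
  refine H ?_ _ (mem_univ _)
  rw [Real.dist_eq, sub_zero]
  linarith

theorem exists_dist_flow_lt [CompactSpace X] (φ : Flow ℝ X) (T : ℝ) {ε : ℝ} (hε : 0 < ε) :
    ∃ δ > 0, ∀ x y, dist x y < δ → ∀ t ∈ Icc 0 T, dist (φ t x) (φ t y) < ε := by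
  refine exists_uniform_of_eventually_diagonal
    (P := fun q => ∀ t ∈ Icc 0 T, dist (φ t q.1) (φ t q.2) < ε) fun z => ?_
  refine isCompact_Icc.eventually_forall_of_forall_eventually fun t _ => ?_
  have hc : Continuous (fun q : (X × X) × ℝ => dist (φ q.2 q.1.1) (φ q.2 q.1.2)) :=
    (φ.continuous continuous_snd (continuous_fst.comp continuous_fst)).dist
      (φ.continuous continuous_snd (continuous_snd.comp continuous_fst))
  exact hc.continuousAt.eventually (gt_mem_nhds (by simpa using hε))

/-- The cocycle identity holds without restriction on every ball of radius `δ`. -/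
def IsCocycleScale (α : X → X → ℝ) (δ : ℝ) : Prop :=
  0 < δ ∧ ∀ c, ∀ x ∈ ball c δ, ∀ y ∈ ball c δ, ∀ z ∈ ball c δ, α x z = α x y + α y z

theorem IsCocycle.exists_uniform [CompactSpace X] {α : X → X → ℝ} (hα : IsCocycle α) :
    ∃ δ, IsCocycleScale α δ := by
  have h : ∀ w : X, ∃ ε > 0, ∀ x ∈ ball w ε, ∀ y ∈ ball w ε, ∀ z ∈ ball w ε,
      α x z = α x y + α y z := by
    intro w
    obtain ⟨ε, hε, H⟩ := Metric.eventually_nhds_iff.1 (hα.2 w)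
    refine ⟨ε, hε, fun x hx y hy z hz => ?_⟩
    have := @H (x, y, z) (by
      rw [mem_ball] at hx hy hz
      simp [Prod.dist_eq, hx, hy, hz])
    simp only at this
    linarith
  choose ε hε H using h
  obtain ⟨δ, hδ, hδ'⟩ := lebesgue_number_lemma_of_metric (isCompact_univ (X := X))
    (c := fun w => ball w (ε w)) (fun w => isOpen_ball)
    (fun w _ => mem_iUnion.2 ⟨w, mem_ball_self (hε w)⟩)
  refine ⟨δ, hδ, fun c x hx y hy z hz => ?_⟩
  obtain ⟨w, hw⟩ := hδ' c (mem_univ _)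
  exact H w x (hw hx) y (hw hy) z (hw hz)

theorem IsCocycle.self_eq_zero {α : X → X → ℝ} (hα : IsCocycle α) (x : X) : α x x = 0 := by
  have := (hα.2 x).self_of_nhds
  simpa using this

theorem IsCocycle.isPrimitiveOn_of_subset_ball {α : X → X → ℝ} (hα : IsCocycle α) {δ : ℝ}
    (hδ : IsCocycleScale α δ) {S : Set X} {c : X} (hS : S ⊆ ball c δ) :
    IsPrimitiveOn α S (α c) := by
  obtain ⟨M, hM⟩ := hα.1
  refine ⟨⟨M, fun x _ => hM c x⟩, fun z _ => ?_⟩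
  filter_upwards [self_mem_nhdsWithin] with q hq
  rw [hδ.2 c c (mem_ball_self hδ.1) q.1 (hS hq.1) q.2 (hS hq.2)]
  ring

/-! ### Integration along trajectories -/

/-- The integral along a curve is the increment of any function of the parameter whose increments
over short intervals are the values of the cocycle. -/
theorem IsIntegralAlong.eq_sub {α : X → X → ℝ} {γ : ℝ → X} (hγ : Continuous γ) {A : ℝ → ℝ}
    {a b η J : ℝ} (hη : 0 < η)
    (hA : ∀ u ∈ Icc a b, ∀ v ∈ Icc a b, u ≤ v → v ≤ u + η → A v - A u = α (γ u) (γ v))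
    (hJ : IsIntegralAlong α γ a b J) : J = A b - A a := by
  obtain ⟨n, t, c, R, β, rfl, rfl, H, rfl⟩ := hJ
  have hlo : ∀ j ≤ n, t 0 ≤ t j := by
    intro j
    induction j with
    | zero => intro _; exact le_rfl
    | succ j ih => intro hj; exact (ih (by omega)).trans (H j (by omega)).1
  have hhi : ∀ k j, j + k = n → t j ≤ t n := by
    intro k
    induction k with
    | zero => rintro j rfl; exact le_rfl
    | succ k ih => intro j hj; exact (H j (by omega)).1.trans (ih (j + 1) (by omega))
  rw [← Finset.sum_range_sub (fun j => A (t j))]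
  refine Finset.sum_congr rfl fun j hj => ?_
  rw [Finset.mem_range] at hj
  obtain ⟨hle, hball, hprim⟩ := H j hj
  have hsub : Icc (t j) (t (j + 1)) ⊆ Icc (t 0) (t n) :=
    Icc_subset_Icc (hlo j hj.le) (hhi (n - (j + 1)) (j + 1) (by omega))
  have key : β j (γ (t j)) - A (t j) = β j (γ (t (j + 1))) - A (t (j + 1)) := by
    refine (isPreconnected_Icc (a := t j) (b := t (j + 1))).induction₂
      (fun u v => β j (γ u) - A u = β j (γ v) - A v) ?_
      (fun _ _ _ _ _ _ h1 h2 => h1.trans h2) (fun _ _ _ _ h => h.symm)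
      (left_mem_Icc.2 hle) (right_mem_Icc.2 hle)
    intro u hu
    have hmem : ∀ v ∈ Icc (t j) (t (j + 1)), γ v ∈ closure (ball (c j) (R j)) :=
      fun v hv => subset_closure (hball v hv)
    have e := hprim.2 (γ u) (hmem u hu)
    have ht1 : Tendsto (fun v => (γ u, γ v)) (𝓝[Icc (t j) (t (j + 1))] u)
        (𝓝[closure (ball (c j) (R j)) ×ˢ closure (ball (c j) (R j))] (γ u, γ u)) := by
      refine tendsto_nhdsWithin_iff.2 ⟨?_, ?_⟩
      · exact ((continuous_const.prodMk hγ).tendsto u).mono_left nhdsWithin_le_nhds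
      · filter_upwards [self_mem_nhdsWithin] with v hv
        exact ⟨hmem u hu, hmem v hv⟩
    have ht2 : Tendsto (fun v => (γ v, γ u)) (𝓝[Icc (t j) (t (j + 1))] u)
        (𝓝[closure (ball (c j) (R j)) ×ˢ closure (ball (c j) (R j))] (γ u, γ u)) := by
      refine tendsto_nhdsWithin_iff.2 ⟨?_, ?_⟩
      · exact ((hγ.prodMk continuous_const).tendsto u).mono_left nhdsWithin_le_nhds
      · filter_upwards [self_mem_nhdsWithin] with v hv
        exact ⟨hmem v hv, hmem u hu⟩
    have h3 : ∀ᶠ v in 𝓝[Icc (t j) (t (j + 1))] u, dist v u < η :=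
      nhdsWithin_le_nhds (Metric.ball_mem_nhds u hη)
    filter_upwards [ht1.eventually e, ht2.eventually e, h3, self_mem_nhdsWithin]
      with v h1 h2 h3 hv
    rw [Real.dist_eq, abs_lt] at h3
    rcases le_total u v with huv | huv
    · have := hA u (hsub hu) v (hsub hv) huv (by linarith)
      linarith
    · have := hA v (hsub hv) u (hsub hu) huv (by linarith)
      linarith
  linarith

/-- The sum of the values of `α` over the division of `[x, x · t]` into pieces of time length `η`
and a remainder. -/
noncomputable def dividedSum (φ : Flow ℝ X) (α : X → X → ℝ) (x : X) (η t : ℝ) : ℝ :=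
  ∑ k ∈ Finset.range ⌊t / η⌋₊, α (φ (k * η) x) (φ ((k + 1 : ℕ) * η) x) +
    α (φ (⌊t / η⌋₊ * η) x) (φ t x)

theorem dividedSum_sub {φ : Flow ℝ X} {α : X → X → ℝ} {δ η : ℝ}
    (hδ : IsCocycleScale α δ) (hη : 0 < η)
    (hd : ∀ x u v, |u - v| ≤ 2 * η → dist (φ u x) (φ v x) < δ) (x : X) {u v : ℝ} (hu : 0 ≤ u)
    (huv : u ≤ v) (hvu : v ≤ u + η) :
    dividedSum φ α x η v - dividedSum φ α x η u = α (φ u x) (φ v x) := by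
  have hu1 : (⌊u / η⌋₊ : ℝ) * η ≤ u := (le_div_iff₀ hη).1 (Nat.floor_le (by positivity))
  have hu2 : u < (⌊u / η⌋₊ + 1 : ℝ) * η := (div_lt_iff₀ hη).1 (Nat.lt_floor_add_one _)
  have hv1 : (⌊v / η⌋₊ : ℝ) * η ≤ v :=
    (le_div_iff₀ hη).1 (Nat.floor_le (div_nonneg (hu.trans huv) hη.le))
  have hv2 : v < (⌊v / η⌋₊ + 1 : ℝ) * η := (div_lt_iff₀ hη).1 (Nat.lt_floor_add_one _)
  have hle : ⌊u / η⌋₊ ≤ ⌊v / η⌋₊ := Nat.floor_mono (by gcongr)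
  have hle2 : ⌊v / η⌋₊ ≤ ⌊u / η⌋₊ + 1 := by
    have : (⌊v / η⌋₊ : ℝ) < ⌊u / η⌋₊ + 2 := by
      by_contra! h
      nlinarith
    have : ⌊v / η⌋₊ < ⌊u / η⌋₊ + 2 := by exact_mod_cast this
    omega
  -- The point `x · (k η)` with `k = ⌊u / η⌋` is the centre of a ball that contains all points
  -- of the division that matter.
  set c := φ (⌊u / η⌋₊ * η) x with hc
  have hmem : ∀ w, ⌊u / η⌋₊ * η ≤ w → w ≤ ⌊u / η⌋₊ * η + 2 * η → φ w x ∈ ball c δ := by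
    intro w h1 h2
    rw [mem_ball]
    exact hd x _ _ (by rw [abs_le]; constructor <;> linarith)
  have hcc : c ∈ ball c δ := mem_ball_self hδ.1
  have hcu := hmem u hu1 (by linarith)
  have hcv := hmem v (hu1.trans huv) (by linarith)
  rcases (by omega : ⌊v / η⌋₊ = ⌊u / η⌋₊ ∨ ⌊v / η⌋₊ = ⌊u / η⌋₊ + 1) with h | h
  · unfold dividedSum
    rw [h, ← hc, hδ.2 c c hcc _ hcu _ hcv]
    ring
  · unfold dividedSum
    have hcm := hmem ((⌊u / η⌋₊ + 1 : ℕ) * η) (by push_cast; linarith) (by push_cast; linarith)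
    rw [h, Finset.sum_range_succ, ← hc]
    have e1 := hδ.2 c c hcc _ hcu _ hcv
    have e2 := hδ.2 c c hcc _ hcm _ hcv
    linarith

theorem exists_isIntegralAlong {φ : Flow ℝ X} {α : X → X → ℝ} (hα : IsCocycle α) {δ η : ℝ}
    (hδ : IsCocycleScale α δ) (hη : 0 < η)
    (hd : ∀ x u v, |u - v| ≤ η → dist (φ u x) (φ v x) < δ / 2) (x : X) {T : ℝ} (hT : 0 ≤ T) :
    ∃ J, IsIntegralAlong α (fun t : ℝ => φ t x) 0 T J := by
  obtain ⟨n, hn⟩ := exists_nat_gt (T / η)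
  have hn0 : (0 : ℝ) < n := (div_nonneg hT hη.le).trans_lt hn
  have hstep : T / n ≤ η := by
    rw [div_lt_iff₀ hη] at hn
    rw [div_le_iff₀ hn0]
    linarith
  have hstep0 : 0 ≤ T / n := by positivity
  refine ⟨_, n, fun j => j * (T / n), fun j => φ (j * (T / n)) x, fun _ => δ / 2,
    fun j => α (φ (j * (T / n)) x), by simp, by field_simp, fun j _ => ⟨?_, ?_, ?_⟩, rfl⟩
  · push_cast; linarith
  · intro u hu
    rw [mem_ball]
    refine hd x _ _ ?_
    have h2 := hu.2
    have h1 := hu.1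
    push_cast at h2
    rw [abs_le]
    constructor <;> linarith
  · refine hα.isPrimitiveOn_of_subset_ball hδ ?_
    exact closure_ball_subset_closedBall.trans (closedBall_subset_ball (by linarith [hδ.1]))

theorem orbitIntegral_eq_sub [CompactSpace X] {φ : Flow ℝ X} {α : X → X → ℝ} (hα : IsCocycle α)
    {x : X} {T : ℝ} (hT : 0 ≤ T) {A : ℝ → ℝ} {η : ℝ} (hη : 0 < η)
    (hA : ∀ u ∈ Icc 0 T, ∀ v ∈ Icc 0 T, u ≤ v → v ≤ u + η → A v - A u = α (φ u x) (φ v x)) :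
    orbitIntegral φ α x T = A T - A 0 := by
  obtain ⟨δ, hδ⟩ := hα.exists_uniform
  obtain ⟨η', hη', hd⟩ := exists_time_dist_lt φ (half_pos hδ.1)
  have hex := exists_isIntegralAlong hα hδ hη' hd x hT
  have : IsIntegralAlong α (fun t : ℝ => φ t x) 0 T (orbitIntegral φ α x T) := by
    unfold orbitIntegral curveIntegral
    rw [dif_pos hex]
    exact hex.choose_spec
  exact this.eq_sub (φ.continuous continuous_id continuous_const) hη hA

/-- Existence of the integral as a function of time. -/
theorem exists_orbit_primitive [CompactSpace X] (φ : Flow ℝ X) {α : X → X → ℝ}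
    (hα : IsCocycle α) : ∃ η > 0, ∀ x : X, ∃ A : ℝ → ℝ, ∀ u v, 0 ≤ u → u ≤ v → v ≤ u + η →
      A v - A u = α (φ u x) (φ v x) := by
  obtain ⟨δ, hδ⟩ := hα.exists_uniform
  obtain ⟨η, hη, hd⟩ := exists_time_dist_lt φ hδ.1
  exact ⟨η / 2, half_pos hη, fun x => ⟨dividedSum φ α x (η / 2), fun u v hu huv hvu =>
    dividedSum_sub hδ (half_pos hη) (fun x u v h => hd x u v (by linarith)) x hu huv hvu⟩⟩

theorem orbitIntegral_add [CompactSpace X] {φ : Flow ℝ X} {α : X → X → ℝ} (hα : IsCocycle α)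
    (x : X) {s t : ℝ} (hs : 0 ≤ s) (ht : 0 ≤ t) :
    orbitIntegral φ α x (s + t) = orbitIntegral φ α x s + orbitIntegral φ α (φ s x) t := by
  obtain ⟨η, hη, H⟩ := exists_orbit_primitive φ hα
  obtain ⟨A, hA⟩ := H x
  rw [orbitIntegral_eq_sub hα (by positivity) hη (fun u hu v _ => hA u v hu.1),
    orbitIntegral_eq_sub hα hs hη (fun u hu v _ => hA u v hu.1),
    orbitIntegral_eq_sub (A := fun u => A (u + s)) hα ht hη]
  · simp only [zero_add, add_comm t s]; ring
  · intro u hu v _ huv hvu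
    simp only [← φ.map_add]
    exact hA _ _ (add_nonneg hu.1 hs) (by linarith) (by linarith)

theorem exists_orbitIntegral_eq [CompactSpace X] (φ : Flow ℝ X) {α : X → X → ℝ}
    (hα : IsCocycle α) : ∃ η > 0, ∀ (x : X) (t : ℝ), 0 ≤ t → t ≤ η →
      orbitIntegral φ α x t = α x (φ t x) := by
  obtain ⟨η, hη, H⟩ := exists_orbit_primitive φ hα
  refine ⟨η, hη, fun x t ht htη => ?_⟩
  obtain ⟨A, hA⟩ := H x
  rw [orbitIntegral_eq_sub hα ht hη (fun u hu v _ => hA u v hu.1),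
    hA 0 t le_rfl ht (by linarith), φ.map_zero_apply]

theorem orbitIntegral_zero [CompactSpace X] (φ : Flow ℝ X) {α : X → X → ℝ}
    (hα : IsCocycle α) (x : X) : orbitIntegral φ α x 0 = 0 := by
  obtain ⟨η, hη, H⟩ := exists_orbitIntegral_eq φ hα
  rw [H x 0 le_rfl hη.le, φ.map_zero_apply, hα.self_eq_zero]

theorem exists_abs_orbitIntegral_le [CompactSpace X] (φ : Flow ℝ X) {α : X → X → ℝ}
    (hα : IsCocycle α) (T : ℝ) : ∃ C, ∀ (x : X) (t : ℝ), 0 ≤ t → t ≤ T →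
      |orbitIntegral φ α x t| ≤ C := by
  obtain ⟨η, hη, H⟩ := exists_orbitIntegral_eq φ hα
  obtain ⟨M, hM⟩ := hα.1
  have key : ∀ n : ℕ, ∀ (x : X) (t : ℝ), 0 ≤ t → t ≤ (n + 1) * η →
      |orbitIntegral φ α x t| ≤ (n + 1) * M := by
    intro n
    induction n with
    | zero =>
      intro x t ht htn
      rw [H x t ht (by simpa using htn)]
      simpa using hM _ _
    | succ n ih =>
      intro x t ht htn
      push_cast at htn ⊢
      rcases le_total t η with h | h
      · have := ih x t ht (by nlinarith [(Nat.cast_nonneg n : (0 : ℝ) ≤ n)])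
        have hM0 : 0 ≤ M := (abs_nonneg _).trans (hM x x)
        linarith
      · have e := orbitIntegral_add (φ := φ) hα x hη.le (sub_nonneg.2 h)
        rw [add_sub_cancel] at e
        rw [e]
        have h1 := ih (φ η x) (t - η) (sub_nonneg.2 h) (by linarith)
        rw [H x η hη.le le_rfl]
        have h2 := abs_add_le (α x (φ η x)) (orbitIntegral φ α (φ η x) (t - η))
        have h3 := hM x (φ η x)
        linarith
  obtain ⟨n, hn⟩ := exists_nat_gt (T / η)
  refine ⟨(n + 1) * M, fun x t ht htT => key n x t ht ?_⟩
  rw [div_lt_iff₀ hη] at hn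
  linarith

theorem IsFixedPoint.orbitIntegral_eq_zero [CompactSpace X] {φ : Flow ℝ X} {α : X → X → ℝ}
    (hα : IsCocycle α) {p : X} (hp : IsFixedPoint φ p) {t : ℝ} (ht : 0 ≤ t) :
    orbitIntegral φ α p t = 0 := by
  rw [orbitIntegral_eq_sub (A := fun _ => 0) (η := 1) hα ht one_pos, sub_zero]
  intro u _ v _ _ _
  rw [hp u, hp v, hα.self_eq_zero, sub_zero]

/-! ### Chain recurrence and Lyapunov functions -/

/-- `y` is within distance `ε` of the image of `x`: one step of an `ε`-chain of the map `f`. The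
relation `Relation.TransGen (ChainStep f ε)` expresses that an `ε`-chain leads from one point to
another. -/
def ChainStep (f : X → X) (ε : ℝ) (x y : X) : Prop :=
  dist (f x) y < ε

theorem ChainStep.mono {f : X → X} {ε ε' : ℝ} (h : ε ≤ ε') {x y : X} (hxy : ChainStep f ε x y) :
    ChainStep f ε' x y :=
  hxy.trans_le h

theorem chain_mono {f : X → X} {ε ε' : ℝ} (h : ε ≤ ε') {x y : X}
    (hxy : Relation.TransGen (ChainStep f ε) x y) : Relation.TransGen (ChainStep f ε') x y :=
  Relation.TransGen.mono (fun _ _ => ChainStep.mono h) _ _ hxy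

theorem chain_change_last {f : X → X} {ε d : ℝ} {x y y' : X}
    (hxy : Relation.TransGen (ChainStep f ε) x y) (hd : dist y y' ≤ d) :
    Relation.TransGen (ChainStep f (ε + d)) x y' := by
  have hd0 : 0 ≤ d := dist_nonneg.trans hd
  have key : ∀ z, ChainStep f ε z y → ChainStep f (ε + d) z y' := fun z hz =>
    (dist_triangle _ y _).trans_lt (add_lt_add_of_lt_of_le hz hd)
  cases hxy with
  | single h => exact .single (key _ h)
  | tail h1 h2 => exact (chain_mono (by linarith) h1).tail (key _ h2)

theorem chain_change_first {f : X → X} {ε d : ℝ} {x x' y : X}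
    (hxy : Relation.TransGen (ChainStep f ε) x y) (hd : dist (f x') (f x) ≤ d) :
    Relation.TransGen (ChainStep f (d + ε)) x' y := by
  have hd0 : 0 ≤ d := dist_nonneg.trans hd
  have key : ∀ z, ChainStep f ε x z → ChainStep f (d + ε) x' z := fun z hz =>
    (dist_triangle _ (f x) _).trans_lt (add_lt_add_of_le_of_lt hd hz)
  obtain ⟨z, hz, h⟩ := Relation.TransGen.head'_iff.1 hxy
  exact Relation.TransGen.head' (key _ hz)
    (Relation.ReflTransGen.mono (fun _ _ => ChainStep.mono (by linarith)) _ _ h)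

/-- The infimum of all `ε` for which an `ε`-chain of the map `f` leads from `x` to `y`. As a
function of `y` it is a Lyapunov function of `f`. -/
noncomputable def chainBarrier (f : X → X) (x y : X) : ℝ :=
  sInf {ε | 0 < ε ∧ Relation.TransGen (ChainStep f ε) x y}

theorem chainBarrier_le {f : X → X} {x y : X} {ε : ℝ} (hε : 0 < ε)
    (h : Relation.TransGen (ChainStep f ε) x y) : chainBarrier f x y ≤ ε :=
  csInf_le ⟨0, fun _ h => h.1.le⟩ ⟨hε, h⟩

theorem chain_single_of_dist_lt {f : X → X} {x y : X} {ε : ℝ} (h : dist (f x) y < ε) :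
    Relation.TransGen (ChainStep f ε) x y :=
  .single h

theorem chainBarrier_le_dist (f : X → X) (x y : X) : chainBarrier f x y ≤ dist (f x) y := by
  refine le_of_forall_pos_le_add fun ε hε => ?_
  exact chainBarrier_le (by positivity) (chain_single_of_dist_lt (by linarith))

theorem chain_of_chainBarrier_lt {f : X → X} {x y : X} {ε : ℝ} (h : chainBarrier f x y < ε) :
    Relation.TransGen (ChainStep f ε) x y := by
  obtain ⟨ε', h', hlt⟩ := exists_lt_of_csInf_lt
    (s := {ε | 0 < ε ∧ Relation.TransGen (ChainStep f ε) x y})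
    ⟨dist (f x) y + 1, by positivity, chain_single_of_dist_lt (by linarith)⟩ h
  exact chain_mono hlt.le h'.2

theorem chainBarrier_nonneg (f : X → X) (x y : X) : 0 ≤ chainBarrier f x y :=
  Real.sInf_nonneg fun _ h => h.1.le

theorem chainBarrier_le_add_dist (f : X → X) (x y y' : X) :
    chainBarrier f x y' ≤ chainBarrier f x y + dist y y' := by
  refine le_of_forall_pos_le_add fun ε hε => ?_
  have h0 := chainBarrier_nonneg f x y
  have := chain_change_last
    (chain_of_chainBarrier_lt (lt_add_of_pos_right (chainBarrier f x y) hε)) (le_refl (dist y y'))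
  refine (chainBarrier_le (by positivity) this).trans (by linarith)

theorem continuous_chainBarrier (f : X → X) (x : X) : Continuous (chainBarrier f x) := by
  refine (LipschitzWith.of_le_add fun y y' => ?_).continuous
  rw [dist_comm]
  exact chainBarrier_le_add_dist f x y' y

theorem chainBarrier_apply_le (f : X → X) (x y : X) :
    chainBarrier f x (f y) ≤ chainBarrier f x y := by
  refine le_of_forall_pos_le_add fun ε hε => ?_
  have h0 := chainBarrier_nonneg f x y
  refine chainBarrier_le (by positivity)
    ((chain_of_chainBarrier_lt (lt_add_of_pos_right _ hε)).tail ?_)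
  unfold ChainStep
  rw [dist_self]
  positivity

theorem chainBarrier_apply_lt {f : X → X} {y z : X} {e : ℝ}
    (hy : ¬ Relation.TransGen (ChainStep f e) y y) (hz : dist (f z) (f y) < e / 2) :
    chainBarrier f z (f y) < chainBarrier f z y := by
  refine (chainBarrier_le_dist f z (f y)).trans_lt (hz.trans_le ?_)
  by_contra! h
  refine hy ?_
  rw [dist_comm] at hz
  have := chain_change_first (chain_of_chainBarrier_lt h) hz.le
  rwa [add_halves] at this

/-- A weighted sum of barriers over a dense sequence of base points is a continuous Lyapunov
function of `f`, strictly decreasing off the chain recurrent set. -/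
theorem exists_lyapunov_of_map [CompactSpace X] [Nonempty X] {f : X → X} (hf : Continuous f) :
    ∃ g : X → ℝ, Continuous g ∧ ∀ y, ∀ e > 0, ¬ Relation.TransGen (ChainStep f e) y y →
      g (f y) < g y := by
  set D := Metric.diam (univ : Set X)
  have hD : ∀ x y, chainBarrier f x y ≤ D := fun x y => (chainBarrier_le_dist f x y).trans
    (Metric.dist_le_diam_of_mem isCompact_univ.isBounded (mem_univ _) (mem_univ _))
  have hsum : Summable fun n : ℕ => (1 / 2 : ℝ) ^ n * D := summable_geometric_two.mul_right D
  have hbd : ∀ n y, (1 / 2 : ℝ) ^ n * chainBarrier f (TopologicalSpace.denseSeq X n) y ≤ (1 / 2 : ℝ) ^ n * D :=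
    fun n y => by gcongr; exact hD _ _
  have h0 : ∀ n y, 0 ≤ (1 / 2 : ℝ) ^ n * chainBarrier f (TopologicalSpace.denseSeq X n) y :=
    fun n y => mul_nonneg (by positivity) (chainBarrier_nonneg _ _ _)
  have hs : ∀ y, Summable fun n : ℕ => (1 / 2 : ℝ) ^ n * chainBarrier f (TopologicalSpace.denseSeq X n) y :=
    fun y => hsum.of_nonneg_of_le (fun n => h0 n y) (fun n => hbd n y)
  refine ⟨fun y => ∑' n : ℕ, (1 / 2 : ℝ) ^ n * chainBarrier f (TopologicalSpace.denseSeq X n) y, ?_, ?_⟩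
  · refine continuous_tsum (fun n => continuous_const.mul (continuous_chainBarrier _ _)) hsum
      fun n y => ?_
    rw [Real.norm_eq_abs, abs_of_nonneg (h0 n y)]
    exact hbd n y
  · intro y e he hy
    obtain ⟨n, hn⟩ := (TopologicalSpace.denseRange_denseSeq X).exists_mem_open
      (isOpen_lt (hf.dist continuous_const) continuous_const : IsOpen {z | dist (f z) (f y) < e / 2})
      ⟨y, by simpa using he⟩
    refine (hs (f y)).tsum_lt_tsum (i := n) (fun m => ?_) ?_ (hs y)
    · exact mul_le_mul_of_nonneg_left (chainBarrier_apply_le _ _ _) (by positivity)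
    · exact mul_lt_mul_of_pos_left (chainBarrier_apply_lt hy hn) (by positivity)

theorem IsFixedPoint.of_flow {φ : Flow ℝ X} {x : X} {s : ℝ} (h : IsFixedPoint φ (φ s x)) :
    φ s x = x := by
  have := h (-s)
  rw [← φ.map_add, neg_add_cancel, φ.map_zero_apply] at this
  exact this.symm

theorem not_isFixedPoint_flow {φ : Flow ℝ X} {x : X} (h : ¬ IsFixedPoint φ x) (s : ℝ) :
    ¬ IsFixedPoint φ (φ s x) := fun h' => h (h'.of_flow ▸ h')

/-- The averages over the time interval `[0, τ]` of a Lyapunov function of the time-`τ` map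
decrease along all trajectories. -/
theorem gradientLike_of_not_chainRecurrent [CompactSpace X] [Nonempty X] {φ : Flow ℝ X} {τ : ℝ}
    (h : ∀ x, ¬ IsFixedPoint φ x → ∃ e > 0, ¬ Relation.TransGen (ChainStep (φ τ) e) x x) :
    GradientLike φ := by
  obtain ⟨g, hg, hlt⟩ := exists_lyapunov_of_map (φ.continuous_toFun τ)
  have hcx : ∀ x, Continuous fun s => g (φ s x) := fun x =>
    hg.comp (φ.continuous continuous_id continuous_const)
  refine ⟨fun x => ∫ s in (0 : ℝ)..τ, g (φ s x), ?_, fun x t ht hx _ => ?_⟩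
  · refine (intervalIntegral.continuous_parametric_intervalIntegral_of_continuous'
      (f := fun x s => g (φ s x)) ?_ 0 τ).continuousOn
    exact hg.comp (φ.continuous continuous_snd continuous_fst)
  · have hi : ∀ a b, IntervalIntegrable (fun s => g (φ s x)) MeasureTheory.volume a b :=
      fun a b => (hcx x).intervalIntegrable a b
    have e1 : ∫ s in (0 : ℝ)..τ, g (φ s (φ t x)) = ∫ s in t..(τ + t), g (φ s x) := by
      simp_rw [← φ.map_add]
      rw [intervalIntegral.integral_comp_add_right (fun s => g (φ s x)) t, zero_add]
    have e2 : ∫ s in τ..(τ + t), g (φ s x) = ∫ s in (0 : ℝ)..t, g (φ τ (φ s x)) := by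
      simp_rw [← φ.map_add]
      have := intervalIntegral.integral_comp_add_left (a := 0) (b := t) (fun s => g (φ s x)) τ
      rw [this, add_zero]
    have e3 := intervalIntegral.integral_interval_sub_interval_comm (hi 0 τ) (hi t (τ + t)) (hi 0 t)
    have hcy : Continuous fun s => g (φ τ (φ s x)) := hg.comp ((φ.continuous_toFun τ).comp
      (φ.continuous continuous_id continuous_const))
    have hpos : 0 < ∫ s in (0 : ℝ)..t, (g (φ s x) - g (φ τ (φ s x))) := by
      refine intervalIntegral.intervalIntegral_pos_of_pos ?_ (fun s => ?_) ht
      · exact ((hcx x).sub hcy).intervalIntegrable _ _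
      · obtain ⟨e, he, hne⟩ := h _ (not_isFixedPoint_flow hx s)
        exact sub_pos.2 (hlt _ e he hne)
    rw [intervalIntegral.integral_sub (hi 0 t) (hcy.intervalIntegrable _ _), ← e2] at hpos
    simp only [e1]
    linarith

/-! ### Gluing over finitely many disjoint closed sets -/

theorem exists_glue {ι Y : Type*} {F : Set ι} {S : ι → Set Y}
    (hS : ∀ p ∈ F, ∀ q ∈ F, p ≠ q → Disjoint (S p) (S q)) (f : ι → Y → ℝ) :
    ∃ f' : Y → ℝ, ∀ p ∈ F, ∀ x ∈ S p, f' x = f p x := by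
  classical
  refine ⟨fun x => if h : ∃ p ∈ F, x ∈ S p then f h.choose x else 0, fun p hp x hx => ?_⟩
  have h : ∃ p ∈ F, x ∈ S p := ⟨p, hp, hx⟩
  have e : h.choose = p := by
    by_contra hne
    exact disjoint_left.1 (hS _ h.choose_spec.1 p hp hne) h.choose_spec.2 hx
  simp only [dif_pos h, e]

theorem eventually_mem_of_disjoint_closed {ι : Type*} {F : Set ι} (hF : F.Finite) {S : ι → Set X}
    (hc : ∀ p, IsClosed (S p)) (hS : ∀ p ∈ F, ∀ q ∈ F, p ≠ q → Disjoint (S p) (S q)) {p : ι}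
    (hp : p ∈ F) {z : X} (hz : z ∈ S p) : ∀ᶠ x in 𝓝 z, x ∈ (⋃ q ∈ F, S q) → x ∈ S p := by
  have hcl : IsClosed (⋃ q ∈ F \ {p}, S q) :=
    (hF.subset sdiff_subset).isClosed_biUnion fun q _ => hc q
  have hzn : z ∈ (⋃ q ∈ F \ {p}, S q)ᶜ := by
    simp only [mem_compl_iff, mem_iUnion, not_exists]
    exact fun q hq hzq => disjoint_left.1 (hS p hp q hq.1 (fun h => hq.2 h.symm)) hz hzq
  filter_upwards [hcl.isOpen_compl.mem_nhds hzn] with x hx hxK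
  simp only [mem_iUnion] at hxK
  obtain ⟨q, hq, hxq⟩ := hxK
  by_cases h : q = p
  · exact h ▸ hxq
  · exact absurd (mem_biUnion (show q ∈ F \ {p} from ⟨hq, h⟩) hxq) hx

theorem subset_of_isPreconnected_of_disjoint_closed {ι : Type*} {F : Set ι} (hF : F.Finite)
    {S : ι → Set X} (hc : ∀ p, IsClosed (S p))
    (hS : ∀ p ∈ F, ∀ q ∈ F, p ≠ q → Disjoint (S p) (S q)) {p : ι} (hp : p ∈ F) {C : Set X}
    (hC : IsPreconnected C) (hCK : C ⊆ ⋃ q ∈ F, S q) {z : X} (hzC : z ∈ C) (hz : z ∈ S p) :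
    C ⊆ S p := by
  have hcl : IsClosed (⋃ q ∈ F \ {p}, S q) :=
    (hF.subset sdiff_subset).isClosed_biUnion fun q _ => hc q
  have hd : Disjoint (S p) (⋃ q ∈ F \ {p}, S q) := by
    simp only [disjoint_iUnion_right]
    exact fun q hq => hS p hp q hq.1 (fun h => hq.2 h.symm)
  have hcov : C ⊆ S p ∪ ⋃ q ∈ F \ {p}, S q := by
    intro x hx
    obtain ⟨q, hq, hxq⟩ := mem_iUnion₂.1 (hCK hx)
    by_cases h : q = p
    · exact .inl (h ▸ hxq)
    · exact .inr (mem_biUnion (show q ∈ F \ {p} from ⟨hq, h⟩) hxq)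
  rcases isPreconnected_iff_subset_of_disjoint_closed.1 hC _ _ (hc p) hcl hcov
    (by rw [hd.inter_eq, inter_empty]) with h | h
  · exact h
  · exact absurd (h hzC) (disjoint_left.1 hd hz)

/-! ### The neighbourhood of the fixed points -/

/-- The local data of an `α`-flow, collected over all fixed points: an open neighbourhood `N` of
the set of fixed points with closure `K`, such that the flow is gradient-like in `K` and `α` has on
`K` a primitive `pot` with values in `[0, ρ - gain]`, together with the lower bounds of the integrals
of `α` along trajectories outside `N`. -/
structure FixedPointNhd (φ : Flow ℝ X) (α : X → X → ℝ) where
  /-- the open neighbourhood -/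
  N : Set X
  /-- the least increase of the integral along trajectories that cross the complement of `N` -/
  ρ : ℝ
  /-- the amount by which `ρ` exceeds the oscillation of the primitive -/
  gain : ℝ
  /-- the time in which trajectories that stay outside `N` gain `ρ` -/
  T₀ : ℝ
  /-- the primitive of `α` on the closure of `N` -/
  pot : X → ℝ
  /-- a scale on which the increments of the primitive are given by `α` -/
  δ : ℝ
  isOpen : IsOpen N
  ρ_pos : 0 < ρ
  gain_pos : 0 < gain
  T₀_pos : 0 < T₀
  δ_pos : 0 < δ
  fixed_finite : {p | IsFixedPoint φ p}.Finite
  fixed_mem : ∀ p, IsFixedPoint φ p → p ∈ N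
  /-- distinct fixed points lie in different components of the closure of `N` -/
  fixed_unique : ∀ C ⊆ closure N, IsPreconnected C → ∀ p ∈ C, ∀ q ∈ C, IsFixedPoint φ p →
    IsFixedPoint φ q → p = q
  pot_nonneg : ∀ x ∈ closure N, 0 ≤ pot x
  pot_le : ∀ x ∈ closure N, pot x ≤ ρ - gain
  pot_sub : ∀ x ∈ closure N, ∀ y ∈ closure N, dist x y < δ → pot y - pot x = α x y
  gradientLikeOn : GradientLikeOn φ (closure N)
  crossing : ∀ (x : X) (b : ℝ), 0 < b → (∀ t ∈ Icc 0 b, φ t x ∉ N) →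
    (∀ a' b' : ℝ, a' ≤ 0 → b ≤ b' → (∀ t ∈ Icc a' b', φ t x ∉ N) → a' = 0 ∧ b' = b) →
    ρ ≤ orbitIntegral φ α x b
  staying : ∀ x : X, (∀ t : ℝ, 0 ≤ t → φ t x ∉ N) → ρ ≤ orbitIntegral φ α x T₀

theorem IsAlphaFlow.exists_fixedPointNhd [CompactSpace X] {φ : Flow ℝ X} {α : X → X → ℝ}
    (hα : IsAlphaFlow φ α) : Nonempty (FixedPointNhd φ α) := by
  obtain ⟨-, hfin, r, T₀, ρ, lam, hr, hT₀, hρ, -, hlam, hdisj, hgrad, hprim, hcross, hstay⟩ := hα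
  set F := {p | IsFixedPoint φ p} with hFdef
  set S : X → Set X := fun p => closure (ball p r) with hSdef
  have hc : ∀ p, IsClosed (S p) := fun p => isClosed_closure
  have hS : ∀ p ∈ F, ∀ q ∈ F, p ≠ q → Disjoint (S p) (S q) := fun p hp q hq => hdisj p q hp hq
  have hK : closure (⋃ p ∈ F, ball p r) = ⋃ p ∈ F, S p := hfin.closure_biUnion _
  have hpunct : ∀ x, x ∉ (⋃ p ∈ F, ball p r) ↔ x ∈ punctured φ r := by
    intro x
    simp [punctured, hFdef]
  have hprim' : ∀ p, ∃ β : X → ℝ, p ∈ F → (IsPrimitiveOn α (S p) β ∧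
      ∀ x ∈ S p, ∀ y ∈ S p, |β y - β x| ≤ lam * ρ) := by
    intro p
    by_cases hp : p ∈ F
    · obtain ⟨β, hβ⟩ := hprim p hp
      exact ⟨β, fun _ => hβ⟩
    · exact ⟨0, fun h => absurd h hp⟩
  choose β hβ using hprim'
  have hgrad' : ∀ p, ∃ g : X → ℝ, p ∈ F → (ContinuousOn g (S p) ∧
      ∀ (x : X) (t : ℝ), 0 < t → ¬ IsFixedPoint φ x → (∀ u ∈ Icc 0 t, φ u x ∈ S p) →
        g (φ t x) < g x) := by
    intro p
    by_cases hp : p ∈ F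
    · obtain ⟨g, hg⟩ := hgrad p hp
      exact ⟨g, fun _ => hg⟩
    · exact ⟨0, fun h => absurd h hp⟩
  choose g hg using hgrad'
  obtain ⟨b, hb⟩ := exists_glue hS fun p x => β p x - sInf (β p '' S p)
  obtain ⟨G, hG⟩ := exists_glue hS g
  have hbd : ∀ p ∈ F, BddBelow (β p '' S p) := by
    intro p hp
    obtain ⟨M, hM⟩ := (hβ p hp).1.1
    refine ⟨-M, ?_⟩
    rintro _ ⟨x, hx, rfl⟩
    exact (abs_le.1 (hM x hx)).1
  have hsub : ∃ δ > 0, ∀ x y, dist x y < δ → x ∈ (⋃ p ∈ F, S p) → y ∈ (⋃ p ∈ F, S p) →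
      b y - b x = α x y := by
    refine exists_uniform_of_eventually_diagonal
      (P := fun q => q.1 ∈ (⋃ p ∈ F, S p) → q.2 ∈ (⋃ p ∈ F, S p) → b q.2 - b q.1 = α q.1 q.2)
      fun z => ?_
    by_cases hz : z ∈ (⋃ p ∈ F, S p)
    · obtain ⟨p, hp, hzp⟩ := mem_iUnion₂.1 hz
      have h1 := eventually_mem_of_disjoint_closed hfin hc hS hp hzp
      have h2 := eventually_nhdsWithin_iff.1 ((hβ p hp).1.2 z hzp)
      filter_upwards [h2, (continuous_fst.tendsto (z, z)).eventually h1,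
        (continuous_snd.tendsto (z, z)).eventually h1] with q h2 h3 h4 hq1 hq2
      rw [hb p hp _ (h3 hq1), hb p hp _ (h4 hq2), ← h2 ⟨h3 hq1, h4 hq2⟩]
      ring
    · have hcl : IsClosed (⋃ p ∈ F, S p) := hfin.isClosed_biUnion fun p _ => hc p
      filter_upwards [(continuous_fst.tendsto (z, z)).eventually (hcl.isOpen_compl.mem_nhds hz)]
        with q hq hq1
      exact absurd hq1 hq
  obtain ⟨δ, hδ, hsub⟩ := hsub
  refine ⟨⟨⋃ p ∈ F, ball p r, ρ, (1 - lam) * ρ, T₀, b, δ, isOpen_biUnion fun _ _ => isOpen_ball,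
    hρ, mul_pos (by linarith) hρ, hT₀, hδ, hfin,
    fun p hp => mem_biUnion (show p ∈ F from hp) (mem_ball_self hr), ?_, ?_, ?_, ?_,
    ⟨G, ?_, ?_⟩, ?_, ?_⟩⟩
  · intro C hCK hC p hpC q hqC hp hq
    rw [hK] at hCK
    have hself : ∀ p, p ∈ S p := fun p => subset_closure (mem_ball_self hr)
    have hCp := subset_of_isPreconnected_of_disjoint_closed hfin hc hS hp hC hCK hpC (hself p)
    by_contra hne
    exact disjoint_left.1 (hS p hp q hq hne) (hCp hqC) (hself q)
  · intro x hx
    rw [hK] at hx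
    obtain ⟨p, hp, hxp⟩ := mem_iUnion₂.1 hx
    rw [hb p hp x hxp, sub_nonneg]
    exact csInf_le (hbd p hp) (mem_image_of_mem _ hxp)
  · intro x hx
    rw [hK] at hx
    obtain ⟨p, hp, hxp⟩ := mem_iUnion₂.1 hx
    rw [hb p hp x hxp]
    have : β p x - lam * ρ ≤ sInf (β p '' S p) := by
      refine le_csInf ⟨_, mem_image_of_mem _ hxp⟩ ?_
      rintro _ ⟨y, hy, rfl⟩
      have := (abs_le.1 ((hβ p hp).2 y hy x hxp)).2
      linarith
    linarith
  · intro x hx y hy hxy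
    rw [hK] at hx hy
    exact hsub x y hxy hx hy
  · rw [hK]
    intro z hz
    obtain ⟨p, hp, hzp⟩ := mem_iUnion₂.1 hz
    have h1 := eventually_mem_of_disjoint_closed hfin hc hS hp hzp
    have h2 : ContinuousWithinAt (g p) (⋃ p ∈ F, S p) z := by
      refine ((hg p hp).1 z hzp).mono_of_mem_nhdsWithin ?_
      filter_upwards [self_mem_nhdsWithin, nhdsWithin_le_nhds h1] with x hx hx'
      exact hx' hx
    refine h2.congr_of_eventuallyEq ?_ (hG p hp z hzp)
    filter_upwards [self_mem_nhdsWithin, nhdsWithin_le_nhds h1] with x hx hx'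
    exact hG p hp x (hx' hx)
  · intro x t ht hx hxt
    rw [hK] at hxt
    obtain ⟨p, hp, hxp⟩ := mem_iUnion₂.1 (hxt 0 (left_mem_Icc.2 ht.le))
    have hcon : IsPreconnected ((fun u => φ u x) '' Icc 0 t) :=
      isPreconnected_Icc.image _ (φ.continuous continuous_id continuous_const).continuousOn
    have hall := subset_of_isPreconnected_of_disjoint_closed hfin hc hS hp hcon
      (by rintro _ ⟨u, hu, rfl⟩; exact hxt u hu)
      (mem_image_of_mem _ (left_mem_Icc.2 ht.le)) hxp
    have hall' : ∀ u ∈ Icc 0 t, φ u x ∈ S p := fun u hu => hall (mem_image_of_mem _ hu)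
    rw [φ.map_zero_apply] at hxp
    rw [hG p hp _ (hall' t (right_mem_Icc.2 ht.le)), hG p hp _ hxp]
    exact (hg p hp).2 x t ht hx hall'
  · intro x b hb0 h1 h2
    simp only [hpunct] at h1 h2
    exact hcross x b ⟨hb0, h1, h2⟩
  · intro x hx
    simp only [hpunct] at hx
    exact hstay x (.inl hx)

/-! ### Trajectories along which the integral is bounded -/

namespace FixedPointNhd

variable {φ : Flow ℝ X} {α : X → X → ℝ} (D : FixedPointNhd φ α)

theorem orbitIntegral_eq_of_mem [CompactSpace X] (hα : IsCocycle α) {x : X} {t : ℝ} (ht : 0 ≤ t)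
    (h : ∀ u ∈ Icc 0 t, φ u x ∈ closure D.N) :
    orbitIntegral φ α x t = D.pot (φ t x) - D.pot x := by
  obtain ⟨η, hη, hd⟩ := exists_time_dist_lt φ D.δ_pos
  rw [orbitIntegral_eq_sub (A := fun u => D.pot (φ u x)) hα ht hη, φ.map_zero_apply]
  intro u hu v hv huv hvu
  exact D.pot_sub _ (h u hu) _ (h v hv) (hd _ _ _ (by rw [abs_le]; constructor <;> linarith))

end FixedPointNhd

namespace FixedPointNhd

variable {φ : Flow ℝ X} {α : X → X → ℝ} (D : FixedPointNhd φ α)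

theorem exists_short_integral [CompactSpace X] (hα : IsCocycle α) :
    ∃ η > 0, ∀ (x : X) (t : ℝ), 0 ≤ t → t ≤ η → x ∈ closure D.N → φ t x ∈ closure D.N →
      orbitIntegral φ α x t = D.pot (φ t x) - D.pot x := by
  obtain ⟨η, hη, H⟩ := exists_orbitIntegral_eq φ hα
  obtain ⟨η', hη', hd⟩ := exists_time_dist_lt φ D.δ_pos
  refine ⟨min η η', lt_min hη hη', fun x t ht htη hx hxt => ?_⟩
  rw [H x t ht (htη.trans (min_le_left _ _)), D.pot_sub x hx _ hxt]
  have := hd x 0 t (by rw [zero_sub, abs_neg, abs_of_nonneg ht]; exact htη.trans (min_le_right _ _))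
  rwa [φ.map_zero_apply] at this

/-- A trajectory that stays outside `N` has unbounded integral. -/
theorem exists_mem_of_bounded [CompactSpace X] (hα : IsCocycle α) {M : ℝ}
    (hM : ∀ (x : X) (t : ℝ), 0 ≤ t → |orbitIntegral φ α x t| ≤ M) (x : X) :
    ∃ t, 0 ≤ t ∧ φ t x ∈ D.N := by
  by_contra! h
  have key : ∀ n : ℕ, n * D.ρ ≤ orbitIntegral φ α x (n * D.T₀) := by
    intro n
    induction n with
    | zero => simp [orbitIntegral_zero φ hα]
    | succ n ih =>
      have hn : 0 ≤ n * D.T₀ := mul_nonneg n.cast_nonneg D.T₀_pos.le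
      have e : ((n + 1 : ℕ) : ℝ) * D.T₀ = n * D.T₀ + D.T₀ := by push_cast; ring
      rw [e, orbitIntegral_add hα x hn D.T₀_pos.le]
      have := D.staying (φ (n * D.T₀) x) fun t ht => by
        rw [← φ.map_add]; exact h _ (by positivity)
      push_cast
      linarith
  obtain ⟨n, hn⟩ := exists_nat_gt (M / D.ρ)
  rw [div_lt_iff₀ D.ρ_pos] at hn
  have h1 := (abs_le.1 (hM x (n * D.T₀) (mul_nonneg n.cast_nonneg D.T₀_pos.le))).2
  linarith [key n]

/-- A trajectory that starts in `N` and leaves the closure of `N` comes back to `N`, and meanwhile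
the difference of its integral and the primitive near the fixed points has increased by the
gain. -/
theorem exists_return [CompactSpace X] (hα : IsCocycle α) {M : ℝ}
    (hM : ∀ (x : X) (t : ℝ), 0 ≤ t → |orbitIntegral φ α x t| ≤ M) {z : X} (hz : z ∈ D.N) {t₁ : ℝ}
    (ht₁ : 0 ≤ t₁) (hzt : φ t₁ z ∉ closure D.N) :
    ∃ t, 0 ≤ t ∧ φ t z ∈ D.N ∧ -D.pot z + D.gain ≤ orbitIntegral φ α z t - D.pot (φ t z) := by
  obtain ⟨η, hη, hshort⟩ := D.exists_short_integral hα
  have hcont : Continuous fun t => φ t z := φ.continuous continuous_id continuous_const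
  have hO : IsOpen {t | φ t z ∈ D.N} := D.isOpen.preimage hcont
  have hC : IsClosed {t | φ t z ∈ closure D.N} := isClosed_closure.preimage hcont
  -- `a` is the end of the initial stay in the closure of `N`.
  set S := {t | 0 ≤ t ∧ ∀ u ∈ Icc 0 t, φ u z ∈ closure D.N} with hS
  have hSb : ∀ t ∈ S, t ≤ t₁ := by
    intro t ht
    by_contra! h
    exact hzt (ht.2 t₁ ⟨ht₁, h.le⟩)
  have hSbdd : BddAbove S := ⟨t₁, hSb⟩
  have hS0 : (0 : ℝ) ∈ S := by
    refine ⟨le_rfl, fun u hu => ?_⟩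
    rw [le_antisymm hu.2 hu.1, φ.map_zero_apply]
    exact subset_closure hz
  set a := sSup S with ha
  have ha0 : 0 ≤ a := le_csSup hSbdd hS0
  have haI : ∀ u ∈ Icc 0 a, φ u z ∈ closure D.N := by
    have h1 : ∀ u ∈ Ico 0 a, φ u z ∈ closure D.N := by
      intro u hu
      obtain ⟨s, hs, hus⟩ := exists_lt_of_lt_csSup ⟨0, hS0⟩ hu.2
      exact hs.2 u ⟨hu.1, hus.le⟩
    rcases ha0.eq_or_lt with h | h
    · intro u hu
      rw [← h] at hu
      exact hS0.2 u hu
    · have h2 : closure (Ico 0 a) ⊆ {t | φ t z ∈ closure D.N} := closure_minimal h1 hC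
      rwa [closure_Ico h.ne] at h2
  have hexit : ∃ t₂, a < t₂ ∧ t₂ ≤ a + η ∧ φ t₂ z ∉ closure D.N := by
    by_contra! h
    have : a + η ∈ S := by
      refine ⟨by positivity, fun u hu => ?_⟩
      rcases le_or_gt u a with hua | hua
      · exact haI u ⟨hu.1, hua⟩
      · exact h u hua hu.2
    linarith [le_csSup hSbdd this]
  obtain ⟨t₂, hat₂, ht₂a, hzt₂⟩ := hexit
  have hzt₂N : φ t₂ z ∉ D.N := fun h => hzt₂ (subset_closure h)
  -- `a'` is the beginning of the piece outside `N` that contains `t₂`.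
  set A := {u | u ∈ Icc 0 t₂ ∧ φ u z ∈ D.N} with hA
  have hA0 : (0 : ℝ) ∈ A := ⟨⟨le_rfl, by linarith⟩, by simpa [φ.map_zero_apply] using hz⟩
  have hAbdd : BddAbove A := ⟨t₂, fun u hu => hu.1.2⟩
  set a' := sSup A with ha'
  have ha'0 : 0 ≤ a' := le_csSup hAbdd hA0
  have ha'K : φ a' z ∈ closure D.N :=
    map_mem_closure (f := fun t => φ t z) hcont (csSup_mem_closure ⟨0, hA0⟩ hAbdd) fun u hu => hu.2
  have ha't₂ : a' < t₂ := lt_of_le_of_ne (csSup_le ⟨0, hA0⟩ fun u hu => hu.1.2)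
    fun h => hzt₂ (h ▸ ha'K)
  have ha'N : φ a' z ∉ D.N := by
    intro h
    obtain ⟨ε, hε, hb⟩ := Metric.isOpen_iff.1 hO a' h
    have h1 : a' < min (a' + ε / 2) t₂ := lt_min (by linarith) ha't₂
    have h2 : min (a' + ε / 2) t₂ ∈ A := by
      refine ⟨⟨by linarith, min_le_right _ _⟩, hb ?_⟩
      rw [mem_ball, Real.dist_eq, abs_lt]
      constructor <;> linarith [min_le_left (a' + ε / 2) t₂]
    exact (le_csSup hAbdd h2).not_gt h1
  have hout : ∀ u, a' ≤ u → u ≤ t₂ → φ u z ∉ D.N := by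
    intro u hu1 hu2 h
    rcases hu1.eq_or_lt with rfl | hlt
    · exact ha'N h
    · exact (le_csSup hAbdd (show u ∈ A from ⟨⟨by linarith, hu2⟩, h⟩)).not_gt hlt
  have hIa' : orbitIntegral φ α z a' = D.pot (φ a' z) - D.pot z := by
    rcases le_total a' a with h | h
    · exact D.orbitIntegral_eq_of_mem hα ha'0 fun u hu => haI u ⟨hu.1, hu.2.trans h⟩
    · have e1 := D.orbitIntegral_eq_of_mem hα ha0 haI
      have e2 := orbitIntegral_add (φ := φ) hα z ha0 (sub_nonneg.2 h)
      have e3 := hshort (φ a z) (a' - a) (sub_nonneg.2 h) (by linarith)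
        (haI a ⟨ha0, le_rfl⟩) (by rw [← φ.map_add, sub_add_cancel]; exact ha'K)
      rw [← φ.map_add, sub_add_cancel] at e3
      rw [add_sub_cancel] at e2
      linarith
  -- `b'` is the end of the piece outside `N` that contains `t₂`.
  set B := {u | t₂ ≤ u ∧ φ u z ∈ D.N} with hB
  have hBne : B.Nonempty := by
    obtain ⟨t, ht, htN⟩ := D.exists_mem_of_bounded hα hM (φ t₂ z)
    rw [← φ.map_add] at htN
    exact ⟨t + t₂, by linarith, htN⟩
  have hBbdd : BddBelow B := ⟨t₂, fun u hu => hu.1⟩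
  set b' := sInf B with hb'
  have ht₂b' : t₂ ≤ b' := le_csInf hBne fun u hu => hu.1
  have hb'K : φ b' z ∈ closure D.N :=
    map_mem_closure (f := fun t => φ t z) hcont (csInf_mem_closure hBne hBbdd) fun u hu => hu.2
  have hb'N : φ b' z ∉ D.N := by
    intro h
    have hlt : t₂ < b' := lt_of_le_of_ne ht₂b' fun h' => hzt₂N (h' ▸ h)
    obtain ⟨ε, hε, hb⟩ := Metric.isOpen_iff.1 hO b' h
    have h1 : max (b' - ε / 2) t₂ < b' := max_lt (by linarith) hlt
    have h2 : max (b' - ε / 2) t₂ ∈ B := by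
      refine ⟨le_max_right _ _, hb ?_⟩
      rw [mem_ball, Real.dist_eq, abs_lt]
      constructor <;> linarith [le_max_left (b' - ε / 2) t₂]
    exact (csInf_le hBbdd h2).not_gt h1
  have hout' : ∀ u, a' ≤ u → u ≤ b' → φ u z ∉ D.N := by
    intro u hu1 hu2 h
    rcases le_total u t₂ with h' | h'
    · exact hout u hu1 h' h
    · rcases hu2.eq_or_lt with rfl | hlt
      · exact hb'N h
      · exact (csInf_le hBbdd (show u ∈ B from ⟨h', h⟩)).not_gt hlt
  have hρ : D.ρ ≤ orbitIntegral φ α (φ a' z) (b' - a') := by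
    refine D.crossing (φ a' z) (b' - a') (by linarith) (fun t ht => ?_) fun a₀ b₀ h1 h2 h3 => ?_
    · rw [← φ.map_add]
      exact hout' _ (by linarith [ht.1]) (by linarith [ht.2])
    · constructor
      · by_contra hne
        have hlt : a₀ + a' < a' := by linarith [lt_of_le_of_ne h1 hne]
        obtain ⟨u, hu, hlu⟩ := exists_lt_of_lt_csSup ⟨0, hA0⟩ hlt
        refine h3 (u - a') ⟨by linarith, ?_⟩ ?_
        · linarith [le_csSup hAbdd hu]
        · rw [← φ.map_add, sub_add_cancel]; exact hu.2
      · by_contra hne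
        have hlt : b' < b₀ + a' := by linarith [lt_of_le_of_ne h2 (Ne.symm hne)]
        obtain ⟨u, hu, hlu⟩ := exists_lt_of_csInf_lt hBne hlt
        refine h3 (u - a') ⟨?_, by linarith⟩ ?_
        · linarith [hu.1]
        · rw [← φ.map_add, sub_add_cancel]; exact hu.2
  obtain ⟨u, hu, hub⟩ := exists_lt_of_csInf_lt hBne (show b' < b' + η by linarith)
  have hbu : b' ≤ u := csInf_le hBbdd hu
  refine ⟨u, by linarith [hu.1], hu.2, ?_⟩
  have e1 := orbitIntegral_add (φ := φ) hα z ha'0 (sub_nonneg.2 (ha't₂.le.trans ht₂b'))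
  have e2 := orbitIntegral_add (φ := φ) hα z (show 0 ≤ b' by linarith) (sub_nonneg.2 hbu)
  have e3 := hshort (φ b' z) (u - b') (sub_nonneg.2 hbu) (by linarith) hb'K
    (by rw [← φ.map_add, sub_add_cancel]; exact subset_closure hu.2)
  rw [← φ.map_add, sub_add_cancel] at e3
  rw [add_sub_cancel] at e1 e2
  have h1 := D.pot_nonneg _ ha'K
  have h2 := D.pot_le _ hb'K
  linarith

/-- A trajectory that starts in `N` stays in the closure of `N` from some time on. -/
theorem exists_stay [CompactSpace X] (hα : IsCocycle α) {M : ℝ}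
    (hM : ∀ (x : X) (t : ℝ), 0 ≤ t → |orbitIntegral φ α x t| ≤ M) {z : X} (hz : z ∈ D.N) :
    ∃ t, 0 ≤ t ∧ (∀ u, t ≤ u → φ u z ∈ closure D.N) ∧
      -D.pot z ≤ orbitIntegral φ α z t - D.pot (φ t z) := by
  by_contra! h
  have key : ∀ n : ℕ, ∃ t, 0 ≤ t ∧ φ t z ∈ D.N ∧
      -D.pot z + n * D.gain ≤ orbitIntegral φ α z t - D.pot (φ t z) := by
    intro n
    induction n with
    | zero => exact ⟨0, le_rfl, by simpa [φ.map_zero_apply] using hz,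
        by simp [orbitIntegral_zero φ hα, φ.map_zero_apply]⟩
    | succ n ih =>
      obtain ⟨t, ht, htN, hle⟩ := ih
      have hex : ∃ u, t ≤ u ∧ φ u z ∉ closure D.N := by
        by_contra! h'
        have h1 := h t ht h'
        have h2 : 0 ≤ n * D.gain := mul_nonneg n.cast_nonneg D.gain_pos.le
        linarith
      obtain ⟨u, htu, hu⟩ := hex
      obtain ⟨s, hs, hsN, hsle⟩ := D.exists_return hα hM htN (sub_nonneg.2 htu)
        (by rwa [← φ.map_add, sub_add_cancel])
      rw [← φ.map_add] at hsN hsle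
      refine ⟨s + t, by positivity, hsN, ?_⟩
      rw [add_comm s t] at hsle ⊢
      rw [orbitIntegral_add hα z ht hs]
      push_cast
      linarith
  obtain ⟨n, hn⟩ := exists_nat_gt ((M + D.pot z) / D.gain)
  rw [div_lt_iff₀ D.gain_pos] at hn
  obtain ⟨t, ht, htN, hle⟩ := key n
  have h1 := (abs_le.1 (hM z t ht)).2
  have h2 := D.pot_nonneg _ (subset_closure htN)
  linarith

/-- A trajectory that starts in `N` and does not stay in the closure of `N` gains on its way to
the final stay there. -/
theorem exists_stay_of_exit [CompactSpace X] (hα : IsCocycle α) {M : ℝ}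
    (hM : ∀ (x : X) (t : ℝ), 0 ≤ t → |orbitIntegral φ α x t| ≤ M) {z : X} (hz : z ∈ D.N) {t₁ : ℝ}
    (ht₁ : 0 ≤ t₁) (hzt : φ t₁ z ∉ closure D.N) :
    ∃ t, 0 ≤ t ∧ (∀ u, t ≤ u → φ u z ∈ closure D.N) ∧
      -D.pot z + D.gain ≤ orbitIntegral φ α z t - D.pot (φ t z) := by
  obtain ⟨s, hs, hsN, hsle⟩ := D.exists_return hα hM hz ht₁ hzt
  obtain ⟨t, ht, htK, htle⟩ := D.exists_stay hα hM hsN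
  rw [← φ.map_add, add_comm t s] at htle
  refine ⟨s + t, by positivity, fun u hu => ?_, ?_⟩
  · have := htK (u - s) (by linarith)
    rwa [← φ.map_add, sub_add_cancel] at this
  · rw [orbitIntegral_add hα z hs ht]
    linarith

end FixedPointNhd

/-! ### Limit points of trajectories in sets in which the flow is gradient-like -/

theorem exists_fixed_limit [CompactSpace X] {φ : Flow ℝ X} {K : Set X} (hK : IsClosed K)
    (hg : GradientLikeOn φ K) {τ : ℝ} (hτ : 0 < τ) {z : X} (hz : ∀ t, 0 ≤ t → φ t z ∈ K) :
    ∃ w, IsFixedPoint φ w ∧ ∃ ψ : ℕ → ℕ, StrictMono ψ ∧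
      Tendsto (fun n => φ (ψ n * τ) z) atTop (𝓝 w) := by
  by_cases hzf : IsFixedPoint φ z
  · refine ⟨z, hzf, id, strictMono_id, ?_⟩
    simp only [hzf _]
    exact tendsto_const_nhds
  obtain ⟨g, hgc, hgd⟩ := hg
  obtain ⟨w, ψ, hψ, hw⟩ := CompactSpace.tendsto_subseq fun n : ℕ => φ (n * τ) z
  refine ⟨w, ?_, ψ, hψ, hw⟩
  have hnn : ∀ n : ℕ, 0 ≤ n * τ := fun n => by positivity
  have hanti : Antitone fun n : ℕ => g (φ (n * τ) z) := by
    refine antitone_nat_of_succ_le fun n => ?_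
    have e : ((n + 1 : ℕ) : ℝ) * τ = τ + n * τ := by push_cast; ring
    rw [e, φ.map_add]
    refine (hgd _ _ hτ (not_isFixedPoint_flow hzf _) fun u hu => ?_).le
    rw [← φ.map_add]
    exact hz _ (add_nonneg hu.1 (hnn n))
  have hbdd : BddBelow (range fun n : ℕ => g (φ (n * τ) z)) := by
    refine ((hK.isCompact.image_of_continuousOn hgc).bddBelow).mono ?_
    rintro _ ⟨n, rfl⟩
    exact mem_image_of_mem _ (hz _ (hnn n))
  have hlim := tendsto_atTop_ciInf hanti hbdd
  set L := ⨅ n : ℕ, g (φ (n * τ) z)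
  have hshift : ∀ s, Tendsto (fun n => φ (s + ψ n * τ) z) atTop (𝓝 (φ s w)) := by
    intro s
    simp only [φ.map_add]
    exact ((φ.continuous_toFun s).tendsto w).comp hw
  have hwK : ∀ s, 0 ≤ s → φ s w ∈ K := fun s hs =>
    hK.mem_of_tendsto (hshift s) (Eventually.of_forall fun n => hz _ (add_nonneg hs (hnn _)))
  have hgw : ∀ s, 0 ≤ s → Tendsto (fun n => g (φ (s + ψ n * τ) z)) atTop (𝓝 (g (φ s w))) := by
    intro s hs
    refine (hgc _ (hwK s hs)).tendsto.comp (tendsto_nhdsWithin_iff.2 ⟨hshift s, ?_⟩)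
    exact Eventually.of_forall fun n => hz _ (add_nonneg hs (hnn _))
  have h0 : g w = L := by
    have h1 := hgw 0 le_rfl
    simp only [zero_add, φ.map_zero_apply] at h1
    exact tendsto_nhds_unique h1 (hlim.comp hψ.tendsto_atTop)
  have h1 : g (φ τ w) = L := by
    have h2 : Tendsto (fun n => ψ n + 1) atTop atTop :=
      (tendsto_add_atTop_nat 1).comp hψ.tendsto_atTop
    refine tendsto_nhds_unique (hgw τ hτ.le) ((hlim.comp h2).congr fun n => ?_)
    have e : ((ψ n + 1 : ℕ) : ℝ) * τ = τ + ψ n * τ := by push_cast; ring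
    simp only [Function.comp_apply, e]
  by_contra hwf
  have := hgd w τ hτ hwf fun u hu => hwK u hu.1
  linarith

theorem GradientLikeOn.reverse {φ : Flow ℝ X} {K : Set X} (h : GradientLikeOn φ K) :
    GradientLikeOn φ.reverse K := by
  obtain ⟨g, hgc, hgd⟩ := h
  refine ⟨fun x => -g x, hgc.neg, fun x t ht hx hxt => neg_lt_neg ?_⟩
  have hx' : ¬ IsFixedPoint φ x := fun h => hx fun s => h (-s)
  have := hgd (φ (-t) x) t ht (not_isFixedPoint_flow hx' _) fun u hu => ?_
  · rw [← φ.map_add, add_neg_cancel, φ.map_zero_apply] at this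
    exact this
  · have h1 := hxt (t - u) ⟨by linarith [hu.2], by linarith [hu.1]⟩
    rw [Flow.reverse_apply] at h1
    rw [← φ.map_add]
    convert h1 using 2
    ring

/-! ### Chains of the time-`τ` map and their integrals -/

/-- A weight `J` is carried by some `ε`-chain of `f` from one point to another, where the step from
`a` to `b` has weight `w a b`. -/
inductive WeightedChain (f : X → X) (w : X → X → ℝ) (ε : ℝ) : X → X → ℝ → Prop
  | single {a b : X} : ChainStep f ε a b → WeightedChain f w ε a b (w a b)
  | tail {a b c : X} {J : ℝ} : WeightedChain f w ε a b J → ChainStep f ε b c →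
      WeightedChain f w ε a c (J + w b c)

namespace WeightedChain

variable {f : X → X} {w : X → X → ℝ} {ε : ℝ}

theorem mono {ε' : ℝ} (h : ε ≤ ε') {x y : X} {J : ℝ} (hc : WeightedChain f w ε x y J) :
    WeightedChain f w ε' x y J := by
  induction hc with
  | single hs => exact .single (hs.mono h)
  | tail _ hs ih => exact ih.tail (hs.mono h)

theorem trans {x y z : X} {J J' : ℝ} (h : WeightedChain f w ε x y J)
    (h' : WeightedChain f w ε y z J') : WeightedChain f w ε x z (J + J') := by
  induction h' with
  | single hs => exact h.tail hs
  | tail _ hs ih => rw [← add_assoc]; exact ih.tail hs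

theorem iterate {x : X} {J : ℝ} (h : WeightedChain f w ε x x J) (n : ℕ) :
    WeightedChain f w ε x x ((n + 1) * J) := by
  induction n with
  | zero => simpa using h
  | succ n ih =>
    have e : ((n + 1 : ℕ) + 1 : ℝ) * J = (n + 1) * J + J := by push_cast; ring
    rw [e]
    exact ih.trans h

theorem exists_of_transGen (w : X → X → ℝ) {x y : X}
    (h : Relation.TransGen (ChainStep f ε) x y) : ∃ J, WeightedChain f w ε x y J := by
  induction h with
  | single hs => exact ⟨_, .single hs⟩
  | tail _ hs ih => exact ⟨_, ih.choose_spec.tail hs⟩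

theorem exists_seq {x y : X} {J : ℝ} (h : WeightedChain f w ε x y J) :
    ∃ (n : ℕ) (u : ℕ → X), 0 < n ∧ u n = y ∧ (∀ i < n, ChainStep f ε (u i) (u (i + 1))) ∧
      J = ∑ i ∈ Finset.range n, w (u i) (u (i + 1)) := by
  induction h with
  | @single b hs =>
    refine ⟨1, fun i => if i = 0 then x else b, one_pos, by simp, fun i hi => ?_, by simp⟩
    obtain rfl : i = 0 := by omega
    simpa using hs
  | @tail b c J hc hs ih =>
    obtain ⟨n, u, hn, rfl, hstep, rfl⟩ := ih
    refine ⟨n + 1, fun i => if i ≤ n then u i else c, n.succ_pos, by simp, fun i hi => ?_, ?_⟩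
    · rcases (Nat.lt_succ_iff.1 hi).lt_or_eq with h | rfl
      · simpa [h.le, Nat.succ_le_of_lt h] using hstep i h
      · simpa using hs
    · rw [Finset.sum_range_succ]
      congr 1
      · refine Finset.sum_congr rfl fun i hi => ?_
        have h := Finset.mem_range.1 hi
        simp [h.le, Nat.succ_le_of_lt h]
      · simp

end WeightedChain

/-- The integral of `α` over a step of a chain of the time-`τ` map whose jump is so small that it
is evaluated by `α` itself. -/
noncomputable def stepIntegral (φ : Flow ℝ X) (α : X → X → ℝ) (τ : ℝ) (x y : X) : ℝ :=
  orbitIntegral φ α x τ + α (φ τ x) y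

section

variable {φ : Flow ℝ X} {α : X → X → ℝ} {τ ε : ℝ}

theorem WeightedChain.change_last {δ d : ℝ} (hδ : IsCocycleScale α δ) {x y y' : X} {J : ℝ}
    (h : WeightedChain (φ τ) (stepIntegral φ α τ) ε x y J) (hd : dist y y' ≤ d) (hεd : ε + d ≤ δ) :
    WeightedChain (φ τ) (stepIntegral φ α τ) (ε + d) x y' (J + α y y') := by
  have hd0 : 0 ≤ d := dist_nonneg.trans hd
  have key : ∀ z, ChainStep (φ τ) ε z y → ChainStep (φ τ) (ε + d) z y' ∧
      stepIntegral φ α τ z y + α y y' = stepIntegral φ α τ z y' := by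
    intro z hz
    have h1 : dist (φ τ z) y' < ε + d :=
      (dist_triangle _ y _).trans_lt (add_lt_add_of_lt_of_le hz hd)
    refine ⟨h1, ?_⟩
    unfold ChainStep at hz
    unfold stepIntegral
    rw [hδ.2 (φ τ z) _ (mem_ball_self hδ.1) y (by rw [mem_ball']; linarith) y'
      (by rw [mem_ball']; linarith)]
    ring
  cases h with
  | single hs => rw [(key _ hs).2]; exact .single (key _ hs).1
  | tail hc hs =>
    rw [add_assoc, (key _ hs).2]
    exact (hc.mono (by linarith)).tail (key _ hs).1

theorem WeightedChain.orbit [CompactSpace X] (hα : IsCocycle α) (hτ : 0 ≤ τ) (hε : 0 < ε) (x : X)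
    (n : ℕ) : WeightedChain (φ τ) (stepIntegral φ α τ) ε x (φ ((n + 1 : ℕ) * τ) x)
      (orbitIntegral φ α x ((n + 1 : ℕ) * τ)) := by
  have key : ∀ z, ChainStep (φ τ) ε z (φ τ z) ∧
      stepIntegral φ α τ z (φ τ z) = orbitIntegral φ α z τ := by
    intro z
    unfold ChainStep stepIntegral
    rw [dist_self, hα.self_eq_zero, add_zero]
    exact ⟨hε, rfl⟩
  induction n with
  | zero =>
    have := WeightedChain.single (w := stepIntegral φ α τ) (key x).1
    rw [(key x).2] at this
    simpa using this
  | succ n ih =>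
    have e : ((n + 1 + 1 : ℕ) : ℝ) * τ = (n + 1 : ℕ) * τ + τ := by push_cast; ring
    have := ih.tail (key _).1
    rw [(key _).2, ← φ.map_add] at this
    rw [e, orbitIntegral_add hα x (by positivity) hτ, add_comm _ τ]
    exact this

theorem BallCovering.exists_lebesgue [CompactSpace X] {s : ℝ} (U : BallCovering α s) :
    ∃ ε > 0, ∀ x y, dist x y < ε → ∃ j, x ∈ ball (U.center j) s ∧ y ∈ ball (U.center j) s ∧
      U.prim j y - U.prim j x = α x y := by
  refine exists_uniform_of_eventually_diagonal (P := fun q => ∃ j, q.1 ∈ ball (U.center j) s ∧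
    q.2 ∈ ball (U.center j) s ∧ U.prim j q.2 - U.prim j q.1 = α q.1 q.2) fun z => ?_
  obtain ⟨j, hj⟩ := U.cover z
  have hn : ball (U.center j) s ∈ 𝓝 z := isOpen_ball.mem_nhds hj
  have h1 := eventually_nhdsWithin_iff.1 ((U.isPrimitiveOn j).2 z (subset_closure hj))
  filter_upwards [h1, (continuous_fst.tendsto (z, z)).eventually hn,
    (continuous_snd.tendsto (z, z)).eventually hn] with q h1 h2 h3
  exact ⟨j, h2, h3, h1 ⟨subset_closure h2, subset_closure h3⟩⟩

theorem WeightedChain.exists_chain {s : ℝ} {U : BallCovering α s}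
    (hU : ∀ x y, dist x y < ε → ∃ j, x ∈ ball (U.center j) s ∧ y ∈ ball (U.center j) s ∧
      U.prim j y - U.prim j x = α x y) {x y : X} {J : ℝ}
    (h : WeightedChain (φ τ) (stepIntegral φ α τ) ε x y J) :
    ∃ c : Chain φ U τ, c.integral = J := by
  obtain ⟨n, u, hn, -, hstep, rfl⟩ := h.exists_seq
  choose j h1 h2 h3 using fun i : Fin n => hU _ _ (hstep i i.2)
  refine ⟨⟨n, hn, fun i => u i, fun _ => τ, fun _ => le_rfl, j, fun i => h1 i, fun i => ?_⟩, ?_⟩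
  · simpa using h2 i
  · unfold Chain.integral
    rw [← Finset.sum_add_distrib,
      ← Fin.sum_univ_eq_sum_range (fun i => stepIntegral φ α τ (u i) (u (i + 1)))]
    refine Finset.sum_congr rfl fun i _ => ?_
    have := h3 i
    simp only [Fin.val_castSucc, Fin.val_succ]
    rw [this]
    rfl

/-! ### Consequences of bounded chain integrals -/

section Bounded

variable {M : ℝ}

theorem abs_orbitIntegral_le_of_bounded [CompactSpace X] (hα : IsCocycle α) (hτ : 0 < τ)
    (hε : 0 < ε)
    (hB : ∀ x y J, WeightedChain (φ τ) (stepIntegral φ α τ) ε x y J → |J| ≤ M) :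
    ∃ M', ∀ (x : X) (t : ℝ), 0 ≤ t → |orbitIntegral φ α x t| ≤ M' := by
  obtain ⟨C, hC⟩ := exists_abs_orbitIntegral_le φ hα τ
  refine ⟨M + C, fun x t ht => ?_⟩
  have hM0 : 0 ≤ M := (abs_nonneg _).trans (hB _ _ _ (WeightedChain.orbit hα hτ.le hε x 0))
  have h1 : (⌊t / τ⌋₊ : ℝ) * τ ≤ t := (le_div_iff₀ hτ).1 (Nat.floor_le (by positivity))
  have h2 : t < (⌊t / τ⌋₊ + 1 : ℝ) * τ := (div_lt_iff₀ hτ).1 (Nat.lt_floor_add_one _)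
  have hn : |orbitIntegral φ α x (⌊t / τ⌋₊ * τ)| ≤ M := by
    rcases Nat.eq_zero_or_pos ⌊t / τ⌋₊ with h | h
    · rw [h, Nat.cast_zero, zero_mul, orbitIntegral_zero φ hα, abs_zero]
      exact hM0
    · obtain ⟨k, hk⟩ := Nat.exists_eq_succ_of_ne_zero h.ne'
      rw [hk]
      exact hB _ _ _ (WeightedChain.orbit hα hτ.le hε x k)
  have e := orbitIntegral_add (φ := φ) hα x (by positivity : 0 ≤ (⌊t / τ⌋₊ : ℝ) * τ)
    (sub_nonneg.2 h1)
  rw [add_sub_cancel] at e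
  rw [e]
  exact (abs_add_le _ _).trans (add_le_add hn (hC _ _ (sub_nonneg.2 h1) (by linarith)))

theorem WeightedChain.eq_zero_of_bounded {f : X → X} {w : X → X → ℝ}
    (hB : ∀ x y J, WeightedChain f w ε x y J → |J| ≤ M) {x : X} {J : ℝ}
    (h : WeightedChain f w ε x x J) : J = 0 := by
  by_contra hJ
  obtain ⟨n, hn⟩ := exists_nat_gt (M / |J|)
  rw [div_lt_iff₀ (abs_pos.2 hJ)] at hn
  have := hB _ _ _ (h.iterate n)
  rw [abs_mul, abs_of_nonneg (by positivity : (0 : ℝ) ≤ n + 1)] at this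
  linarith [abs_nonneg J]

theorem WeightedChain.unique_of_bounded {f : X → X} {w : X → X → ℝ}
    (hB : ∀ x y J, WeightedChain f w ε x y J → |J| ≤ M) {x y : X} {J J' L : ℝ}
    (h : WeightedChain f w ε x y J) (h' : WeightedChain f w ε x y J')
    (hL : WeightedChain f w ε y x L) : J = J' := by
  have h1 := (h.trans hL).eq_zero_of_bounded hB
  have h2 := (h'.trans hL).eq_zero_of_bounded hB
  linarith

end Bounded

end

/-! ### The chain relation -/

/-- For all `ε > 0` there is an `ε`-chain of `f` from `x` to `y`. -/
def ChainsTo (f : X → X) (x y : X) : Prop :=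
  ∀ ε > 0, Relation.TransGen (ChainStep f ε) x y

namespace ChainsTo

variable {f : X → X} {x y z : X}

theorem trans (h : ChainsTo f x y) (h' : ChainsTo f y z) : ChainsTo f x z :=
  fun ε hε => (h ε hε).trans (h' ε hε)

theorem apply_right (h : ChainsTo f x y) : ChainsTo f x (f y) :=
  fun ε hε => (h ε hε).tail (by unfold ChainStep; simpa using hε)

theorem of_limit_right (h : ∀ ε > 0, ∃ y', dist y' y < ε ∧ Relation.TransGen (ChainStep f ε) x y') :
    ChainsTo f x y := by
  intro ε hε
  obtain ⟨y', hd, hc⟩ := h (ε / 2) (half_pos hε)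
  simpa using chain_change_last hc hd.le

theorem of_limit_left [CompactSpace X] (hf : Continuous f)
    (h : ∀ ε > 0, ∃ x', dist x x' < ε ∧ Relation.TransGen (ChainStep f ε) x' y) :
    ChainsTo f x y := by
  intro ε hε
  obtain ⟨δ, hδ, H⟩ := Metric.uniformContinuous_iff.1
    (CompactSpace.uniformContinuous_of_continuous hf) (ε / 2) (half_pos hε)
  obtain ⟨x', hd, hc⟩ := h (min δ (ε / 2)) (lt_min hδ (half_pos hε))
  have := chain_change_first (chain_mono (min_le_right _ _) hc)
    (H (hd.trans_le (min_le_left _ _))).le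
  simpa using this

theorem apply_left [CompactSpace X] (hf : Continuous f) (h : ChainsTo f x y)
    (hy : ChainsTo f y y) : ChainsTo f (f x) y := by
  refine of_limit_left hf fun ε hε => ?_
  obtain ⟨z, hz, hc⟩ := Relation.TransGen.head'_iff.1 (h ε hε)
  exact ⟨z, hz, Relation.TransGen.trans_right hc (hy ε hε)⟩

end ChainsTo

theorem ChainsTo.flow_right {φ : Flow ℝ X} {τ : ℝ} {x z : X} (h : ChainsTo (φ τ) x z) (m : ℕ) :
    ChainsTo (φ τ) x (φ (m * τ) z) := by
  induction m with
  | zero => simpa [φ.map_zero_apply] using h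
  | succ m ih =>
    have e : ((m + 1 : ℕ) : ℝ) * τ = τ + m * τ := by push_cast; ring
    rw [e, φ.map_add]
    exact ih.apply_right

theorem ChainsTo.flow_left [CompactSpace X] {φ : Flow ℝ X} {τ : ℝ} {x z : X}
    (h : ChainsTo (φ τ) z x) (hx : ChainsTo (φ τ) x x) (m : ℕ) :
    ChainsTo (φ τ) (φ (m * τ) z) x := by
  induction m with
  | zero => simpa [φ.map_zero_apply] using h
  | succ m ih =>
    have e : ((m + 1 : ℕ) : ℝ) * τ = τ + m * τ := by push_cast; ring
    rw [e, φ.map_add]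
    exact ih.apply_left (φ.continuous_toFun τ) hx

/-- The first point of an `ε`-chain from `q` outside of a ball about `q`, together with the
preceding points in the ball, continued backwards by `q`. -/
theorem exists_first_exit {f : X → X} {q : X} (hq : f q = q) {ε r : ℝ} (hε : 0 < ε) (hr : 0 < r)
    {x : X} (hx : x ∉ ball q r) (h : Relation.TransGen (ChainStep f ε) q x) :
    ∃ v : ℕ → X, v 0 ∉ ball q r ∧ (∀ i, v (i + 1) ∈ ball q r) ∧
      (∀ i, ChainStep f ε (v (i + 1)) (v i)) ∧ Relation.TransGen (ChainStep f ε) q (v 0) ∧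
      Relation.ReflTransGen (ChainStep f ε) (v 0) x := by
  have key : ∀ z, Relation.TransGen (ChainStep f ε) q z →
      (∃ v : ℕ → X, v 0 = z ∧ (∀ i, v (i + 1) ∈ ball q r) ∧
        (∀ i, ChainStep f ε (v (i + 1)) (v i))) ∨
      ∃ v : ℕ → X, v 0 ∉ ball q r ∧ (∀ i, v (i + 1) ∈ ball q r) ∧
      (∀ i, ChainStep f ε (v (i + 1)) (v i)) ∧ Relation.TransGen (ChainStep f ε) q (v 0) ∧
      Relation.ReflTransGen (ChainStep f ε) (v 0) z := by
    intro z hz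
    induction hz with
    | @single b hs =>
      left
      refine ⟨fun i => Nat.casesOn i b fun _ => q, rfl, fun i => mem_ball_self hr, fun i => ?_⟩
      cases i with
      | zero => exact hs
      | succ i => unfold ChainStep; simpa [hq] using hε
    | @tail b c hqb hs ih =>
      rcases ih with ⟨v, rfl, hv1, hv2⟩ | ⟨v, hv0, hv1, hv2, hv3, hv4⟩
      · by_cases hb : v 0 ∈ ball q r
        · left
          refine ⟨fun i => Nat.casesOn i c fun k => v k, rfl, fun i => ?_, fun i => ?_⟩
          · cases i with
            | zero => exact hb
            | succ i => exact hv1 i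
          · cases i with
            | zero => exact hs
            | succ i => exact hv2 i
        · exact .inr ⟨v, hb, hv1, hv2, hqb, .single hs⟩
      · exact .inr ⟨v, hv0, hv1, hv2, hv3, hv4.tail hs⟩
  rcases key x h with ⟨v, rfl, hv1, hv2⟩ | h'
  · exact ⟨v, hx, hv1, hv2, h, .refl⟩
  · exact h'

/-- If chains with arbitrarily small jumps lead from a fixed point `q` to a point outside of a ball
about `q`, then they lead through a point that is not in the ball and whose whole past is in the
closed ball. -/
theorem exists_unstable_point [CompactSpace X] {φ : Flow ℝ X} {τ r : ℝ} {q x : X}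
    (hq : IsFixedPoint φ q) (hr : 0 < r) (hx : x ∉ ball q r) (hqx : ChainsTo (φ τ) q x)
    (hxx : ChainsTo (φ τ) x x) :
    ∃ y, y ∉ ball q r ∧ ChainsTo (φ τ) q y ∧ ChainsTo (φ τ) y x ∧
      ∀ n : ℕ, φ (-((n + 1 : ℕ) * τ)) y ∈ closedBall q r := by
  have hpos : ∀ k : ℕ, (0 : ℝ) < 1 / (k + 1) := fun k => Nat.one_div_pos_of_nat
  choose v hv0 hv1 hv2 hv3 hv4 using fun k : ℕ =>
    exists_first_exit (hq τ) (hpos k) hr hx (hqx _ (hpos k))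
  obtain ⟨y, ψ, hψ, hy⟩ := CompactSpace.tendsto_subseq fun k => v k 0
  have hlim0 : Tendsto (fun k => (1 : ℝ) / (ψ k + 1)) atTop (𝓝 0) :=
    (tendsto_one_div_add_atTop_nhds_zero_nat (𝕜 := ℝ)).comp hψ.tendsto_atTop
  have hback : ∀ n : ℕ, Tendsto (fun k => v (ψ k) n) atTop (𝓝 (φ (-(n * τ)) y)) := by
    intro n
    induction n with
    | zero => simpa [φ.map_zero_apply, Function.comp_def] using hy
    | succ n ih =>
      have h1 : Tendsto (fun k => φ τ (v (ψ k) (n + 1))) atTop (𝓝 (φ (-(n * τ)) y)) := by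
        refine ih.congr_dist ?_
        refine squeeze_zero (fun _ => dist_nonneg) (fun k => ?_) hlim0
        rw [dist_comm]
        exact (hv2 (ψ k) n).le
      have h2 := ((φ.continuous_toFun (-τ)).tendsto _).comp h1
      rw [← φ.map_add] at h2
      have e : -(((n + 1 : ℕ) : ℝ) * τ) = -τ + -(n * τ) := by push_cast; ring
      rw [e]
      refine h2.congr fun k => ?_
      simp only [Function.comp_apply]
      rw [← φ.map_add, neg_add_cancel, φ.map_zero_apply]
  have hsmall : ∀ ε > 0, ∃ k, (1 : ℝ) / (ψ k + 1) < ε ∧ dist (v (ψ k) 0) y < ε := by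
    intro ε hε
    exact ((hlim0.eventually (gt_mem_nhds hε)).and
      (hy.eventually (ball_mem_nhds y hε))).exists
  refine ⟨y, ?_, ?_, ?_, fun n => ?_⟩
  · exact isOpen_ball.isClosed_compl.mem_of_tendsto hy (Eventually.of_forall fun k => hv0 _)
  · refine ChainsTo.of_limit_right fun ε hε => ?_
    obtain ⟨k, hk1, hk2⟩ := hsmall ε hε
    exact ⟨_, hk2, chain_mono hk1.le (hv3 _)⟩
  · refine ChainsTo.of_limit_left (φ.continuous_toFun τ) fun ε hε => ?_
    obtain ⟨k, hk1, hk2⟩ := hsmall ε hε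
    exact ⟨_, by rwa [dist_comm], chain_mono hk1.le
      (Relation.TransGen.trans_right (hv4 _) (hxx _ (hpos _)))⟩
  · refine isClosed_closedBall.mem_of_tendsto (hback (n + 1)) (Eventually.of_forall fun k => ?_)
    exact ball_subset_closedBall (hv1 _ n)

/-! ### Bounded chain integrals exclude chain recurrent nonconstant orbits -/

theorem isFixedPoint_of_reverse {φ : Flow ℝ X} {x : X} (h : IsFixedPoint φ.reverse x) :
    IsFixedPoint φ x := by
  intro t
  have := h (-t)
  rwa [Flow.reverse_apply, neg_neg] at this

namespace FixedPointNhd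

variable {φ : Flow ℝ X} {α : X → X → ℝ} (D : FixedPointNhd φ α)

/-- A trajectory in a chain class that stays near the fixed points from some time on comes close to
a fixed point of the class at multiples of `τ`. -/
theorem exists_fixed_of_stay [CompactSpace X] {τ : ℝ} (hτ : 0 < τ) {x z : X}
    (hxz : ChainsTo (φ τ) x z) (hzx : ChainsTo (φ τ) z x) {t : ℝ}
    (hstay : ∀ u, t ≤ u → φ u z ∈ closure D.N) :
    ∃ q, IsFixedPoint φ q ∧ ChainsTo (φ τ) x q ∧ ChainsTo (φ τ) q x ∧
      ∀ ε > 0, ∃ m : ℕ, t ≤ (m + 1 : ℕ) * τ ∧ dist (φ ((m + 1 : ℕ) * τ) z) q < ε := by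
  have hxx : ChainsTo (φ τ) x x := hxz.trans hzx
  obtain ⟨k, hk⟩ := exists_nat_gt (t / τ)
  rw [div_lt_iff₀ hτ] at hk
  obtain ⟨q, hq, ψ, hψ, hlim⟩ := exists_fixed_limit isClosed_closure D.gradientLikeOn hτ
    (z := φ ((k + 1 : ℕ) * τ) z) fun s hs => by
      rw [← φ.map_add]
      refine hstay _ ?_
      push_cast
      linarith
  have hclose : ∀ ε > 0, ∃ m : ℕ, t ≤ (m + 1 : ℕ) * τ ∧ dist (φ ((m + 1 : ℕ) * τ) z) q < ε := by
    intro ε hε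
    obtain ⟨n, hn : dist _ q < ε⟩ := (hlim.eventually (ball_mem_nhds q hε)).exists
    refine ⟨ψ n + k, ?_, ?_⟩
    · have : 0 ≤ (ψ n : ℝ) * τ := by positivity
      push_cast
      linarith
    · rw [← φ.map_add] at hn
      convert hn using 3
      push_cast
      ring
  refine ⟨q, hq, ?_, ?_, hclose⟩
  · refine ChainsTo.of_limit_right fun ε hε => ?_
    obtain ⟨m, -, hm⟩ := hclose ε hε
    exact ⟨_, hm, hxz.flow_right _ ε hε⟩
  · intro ε hε
    obtain ⟨m, -, hm⟩ := hclose ε hε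
    refine Relation.TransGen.head (b := φ ((m + 1 : ℕ) * τ) z) ?_ (hzx.flow_left hxx _ ε hε)
    unfold ChainStep
    rwa [hq τ, dist_comm]

/-- An orbit whose past is near the fixed point `q`, in a ball in which `q` is the only fixed
point, does not stay near the fixed points in the future. -/
theorem exists_exit_of_past [CompactSpace X] {τ : ℝ} (hτ : 0 < τ) {q y : X}
    (hq : IsFixedPoint φ q) (hy : ¬ IsFixedPoint φ y)
    (hpast : ∀ t, 0 ≤ t → φ (-t) y ∈ closure D.N) {ψ : ℕ → ℕ}
    (hlim : Tendsto (fun n => φ (-(ψ n * τ)) y) atTop (𝓝 q)) :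
    ∃ t, 0 ≤ t ∧ φ t y ∉ closure D.N := by
  by_contra! hfut
  have hall : ∀ t, φ t y ∈ closure D.N := by
    intro t
    rcases le_total 0 t with h | h
    · exact hfut t h
    · simpa using hpast (-t) (by linarith)
  obtain ⟨w, hw, χ, hχ, hlim'⟩ := exists_fixed_limit isClosed_closure D.gradientLikeOn hτ hfut
  have hcon : IsPreconnected (closure (range fun t => φ t y)) :=
    (isPreconnected_range (φ.continuous continuous_id continuous_const)).closure
  have hsub : closure (range fun t => φ t y) ⊆ closure D.N := by
    refine closure_minimal ?_ isClosed_closure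
    rintro _ ⟨t, rfl⟩
    exact hall t
  have hqC : q ∈ closure (range fun t => φ t y) :=
    isClosed_closure.mem_of_tendsto hlim (Eventually.of_forall fun n =>
      subset_closure (mem_range_self _))
  have hwC : w ∈ closure (range fun t => φ t y) :=
    isClosed_closure.mem_of_tendsto hlim' (Eventually.of_forall fun n =>
      subset_closure (mem_range_self _))
  obtain rfl := D.fixed_unique _ hsub hcon q hqC w hwC hq hw
  obtain ⟨g, hgc, hgd⟩ := D.gradientLikeOn
  have hlt : ∀ s t, s < t → g (φ t y) < g (φ s y) := by
    intro s t hst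
    have := hgd (φ s y) (t - s) (sub_pos.2 hst) (not_isFixedPoint_flow hy s)
      fun u _ => by rw [← φ.map_add]; exact hall _
    rwa [← φ.map_add, sub_add_cancel] at this
  have hqK := hsub hqC
  have h1 : g (φ 0 y) ≤ g q := by
    refine ge_of_tendsto ((hgc q hqK).tendsto.comp (tendsto_nhdsWithin_iff.2
      ⟨hlim, Eventually.of_forall fun n => hall _⟩)) (Eventually.of_forall fun n => ?_)
    have : 0 ≤ (ψ n : ℝ) * τ := by positivity
    rcases this.eq_or_lt with h | h
    · simp [← h]
    · exact (hlt _ _ (by linarith)).le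
  have h2 : g q ≤ g (φ τ y) := by
    refine le_of_tendsto ((hgc q hqK).tendsto.comp (tendsto_nhdsWithin_iff.2
      ⟨hlim', Eventually.of_forall fun n => hall _⟩)) ?_
    filter_upwards [hχ.tendsto_atTop.eventually_gt_atTop 1] with n hn
    refine (hlt _ _ ?_).le
    have : (1 : ℝ) < χ n := by exact_mod_cast hn
    nlinarith
  linarith [hlt 0 τ hτ]

/-- If the fixed point `q` is in the chain class of `x`, which is not fixed, then the class contains
an orbit that starts at `q`, in the sense that its past is near `q`, and leaves the neighbourhood of
the fixed points. -/
theorem exists_leaving_orbit [CompactSpace X] {τ : ℝ} (hτ : 0 < τ) {x q : X}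
    (hx : ¬ IsFixedPoint φ x) (hq : IsFixedPoint φ q) (hqx : ChainsTo (φ τ) q x)
    (hxx : ChainsTo (φ τ) x x) :
    ∃ y, y ∈ D.N ∧ ChainsTo (φ τ) q y ∧ ChainsTo (φ τ) y x ∧
      (∀ t, 0 ≤ t → φ (-t) y ∈ closure D.N) ∧
      (∀ ε > 0, ∃ n : ℕ, dist (φ (-((n + 1 : ℕ) * τ)) y) q < ε) ∧
      ∃ t, 0 ≤ t ∧ φ t y ∉ closure D.N := by
  have hxq : x ≠ q := fun h => hx (h ▸ hq)
  have hO : IsOpen (D.N ∩ ({p | IsFixedPoint φ p} \ {q})ᶜ) :=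
    D.isOpen.inter (D.fixed_finite.subset sdiff_subset).isClosed.isOpen_compl
  obtain ⟨R, hR, hRsub⟩ := Metric.isOpen_iff.1 hO q ⟨D.fixed_mem q hq, fun h => h.2 rfl⟩
  obtain ⟨δ, hδ, hflow⟩ := exists_dist_flow_lt φ τ hR
  obtain ⟨y, hyr, hqy, hyx, hback⟩ := exists_unstable_point (r := min (δ / 2) (dist x q)) hq
    (lt_min (half_pos hδ) (dist_pos.2 hxq)) (by simp) hqx hxx
  have hpast : ∀ t, 0 ≤ t → φ (-t) y ∈ ball q R := by
    intro t ht
    have h1 : (⌊t / τ⌋₊ : ℝ) * τ ≤ t := (le_div_iff₀ hτ).1 (Nat.floor_le (by positivity))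
    have h2 : t < (⌊t / τ⌋₊ + 1 : ℝ) * τ := (div_lt_iff₀ hτ).1 (Nat.lt_floor_add_one _)
    have h3 := hback ⌊t / τ⌋₊
    rw [mem_closedBall] at h3
    have h4 := hflow _ q (h3.trans_lt ((min_le_left _ _).trans_lt (by linarith)))
      (((⌊t / τ⌋₊ + 1 : ℕ) : ℝ) * τ - t) ⟨by push_cast; linarith, by push_cast; linarith⟩
    rw [← φ.map_add, hq] at h4
    rw [mem_ball]
    convert h4 using 3
    ring
  have hyq : y ≠ q := by
    rintro rfl
    exact hyr (mem_ball_self (lt_min (half_pos hδ) (dist_pos.2 hxq)))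
  have hyR : y ∈ ball q R := by simpa [φ.map_zero_apply] using hpast 0 le_rfl
  have hyf : ¬ IsFixedPoint φ y := fun h => (hRsub hyR).2 ⟨h, hyq⟩
  have hpastK : ∀ t, 0 ≤ t → φ (-t) y ∈ closure D.N := fun t ht =>
    subset_closure (hRsub (hpast t ht)).1
  obtain ⟨w, hw, ψ, hψ, hlim⟩ := exists_fixed_limit (φ := φ.reverse) isClosed_closure
    D.gradientLikeOn.reverse hτ (z := y) hpastK
  simp only [Flow.reverse_apply] at hlim
  have hev : ∀ᶠ n in atTop, 0 < ψ n := hψ.tendsto_atTop.eventually_gt_atTop 0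
  have hwR : w ∈ ball q R := by
    have : w ∈ closedBall q (min (δ / 2) (dist x q)) := by
      refine isClosed_closedBall.mem_of_tendsto hlim ?_
      filter_upwards [hev] with n hn
      obtain ⟨k, hk⟩ := Nat.exists_eq_succ_of_ne_zero hn.ne'
      rw [hk]
      exact hback k
    rw [mem_closedBall] at this
    have h4 := hflow _ q (this.trans_lt ((min_le_left _ _).trans_lt (by linarith))) 0
      ⟨le_rfl, hτ.le⟩
    simpa [φ.map_zero_apply] using h4
  obtain rfl : w = q := by
    by_contra h
    exact (hRsub hwR).2 ⟨isFixedPoint_of_reverse hw, h⟩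
  refine ⟨y, (hRsub hyR).1, hqy, hyx, hpastK, fun ε hε => ?_,
    D.exists_exit_of_past hτ hq hyf hpastK hlim⟩
  obtain ⟨n, hn, h0⟩ := ((hlim.eventually (ball_mem_nhds w hε)).and hev).exists
  obtain ⟨k, hk⟩ := Nat.exists_eq_succ_of_ne_zero h0.ne'
  rw [hk] at hn
  exact ⟨k, hn⟩

/-- If the integrals of `α` along all chains are bounded, then all chain recurrent points are fixed.
Assign to each fixed point `q` of the chain class of a recurrent point `x` the integral along chains
from `x` to `q`, diminished by the potential of `q`; this is well defined, as closed chains have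
integral zero. Chains that leave the fixed point with the largest value lead, in the limit, to an
orbit of the class which connects it with a fixed point where the value is larger by the gain. -/
theorem not_chainsTo_self_of_bounded [CompactSpace X] (D : FixedPointNhd φ α) (hα : IsCocycle α) {τ ε M : ℝ} (hτ : 0 < τ)
    (hε : 0 < ε)
    (hB : ∀ x y J, WeightedChain (φ τ) (stepIntegral φ α τ) ε x y J → |J| ≤ M) {x : X}
    (hx : ¬ IsFixedPoint φ x) : ¬ ChainsTo (φ τ) x x := by
  intro hxx
  obtain ⟨δ, hδ⟩ := hα.exists_uniform
  -- Shrink `ε` below the scales on which the cocycle identity and the primitive are available.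
  wlog hεs : ε ≤ δ ∧ ε ≤ D.δ generalizing ε
  · exact this (ε := min ε (min δ D.δ)) (lt_min hε (lt_min hδ.1 D.δ_pos))
      (fun x y J h => hB x y J (h.mono (min_le_left _ _)))
      ⟨(min_le_right _ _).trans (min_le_left _ _), (min_le_right _ _).trans (min_le_right _ _)⟩
  obtain ⟨hεδ, hεD⟩ := hεs
  obtain ⟨M', hM'⟩ := abs_orbitIntegral_le_of_bounded hα hτ hε hB
  set F := {q | IsFixedPoint φ q ∧ ChainsTo (φ τ) x q ∧ ChainsTo (φ τ) q x} with hF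
  have hFfin : F.Finite := D.fixed_finite.subset fun q hq => hq.1
  have hFne : F.Nonempty := by
    obtain ⟨s, hs, hsN⟩ := D.exists_mem_of_bounded hα hM' x
    obtain ⟨t, ht, hstay, -⟩ := D.exists_stay hα hM' hsN
    obtain ⟨q, hq1, hq2, hq3, -⟩ := D.exists_fixed_of_stay hτ hxx hxx (t := t + s) fun u hu => by
      have := hstay (u - s) (by linarith)
      rwa [← φ.map_add, sub_add_cancel] at this
    exact ⟨q, hq1, hq2, hq3⟩
  have hW : ∀ q, ∃ J, q ∈ F → WeightedChain (φ τ) (stepIntegral φ α τ) ε x q J := by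
    intro q
    by_cases hq : q ∈ F
    · obtain ⟨J, hJ⟩ := WeightedChain.exists_of_transGen (stepIntegral φ α τ) (hq.2.1 ε hε)
      exact ⟨J, fun _ => hJ⟩
    · exact ⟨0, fun h => absurd h hq⟩
  choose W hW using hW
  obtain ⟨q, hqF, hmax⟩ := Set.exists_max_image F (fun q => W q - D.pot q) hFfin hFne
  obtain ⟨y, hyN, hqy, hyx, hpast, hclose, t₁, ht₁, hexit⟩ :=
    D.exists_leaving_orbit hτ hx hqF.1 hqF.2.2 hxx
  -- The chain from `q` to `y` through a point of the past of `y` close to `q`.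
  have hchain₁ : WeightedChain (φ τ) (stepIntegral φ α τ) ε q y (D.pot y - D.pot q) := by
    obtain ⟨n, hn⟩ := hclose ε hε
    set y' := φ (-((n + 1 : ℕ) * τ)) y with hy'
    have hn0 : 0 ≤ ((n + 1 : ℕ) : ℝ) * τ := by positivity
    have hy'y : φ ((n + 1 : ℕ) * τ) y' = y := by
      rw [hy', ← φ.map_add, add_neg_cancel, φ.map_zero_apply]
    have h1 : ChainStep (φ τ) ε q y' := by
      unfold ChainStep
      rwa [hqF.1 τ, dist_comm]
    have h2 : stepIntegral φ α τ q y' = D.pot y' - D.pot q := by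
      unfold stepIntegral
      rw [hqF.1.orbitIntegral_eq_zero hα hτ.le, zero_add, hqF.1 τ, D.pot_sub q
        (subset_closure (D.fixed_mem q hqF.1)) _ (hpast _ hn0)]
      rw [dist_comm]
      exact hn.trans_le hεD
    have h3 : orbitIntegral φ α y' ((n + 1 : ℕ) * τ) = D.pot y - D.pot y' := by
      rw [D.orbitIntegral_eq_of_mem hα hn0, hy'y]
      intro u hu
      rw [hy', ← φ.map_add]
      have := hpast ((n + 1 : ℕ) * τ - u) (by linarith [hu.2])
      convert this using 2
      ring
    have h4 := (WeightedChain.single (w := stepIntegral φ α τ) h1).trans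
      (WeightedChain.orbit hα hτ.le hε y' n)
    rw [h2, h3, hy'y] at h4
    convert h4 using 1
    ring
  obtain ⟨t, ht, hstay, hgain⟩ := D.exists_stay_of_exit hα hM' hyN ht₁ hexit
  obtain ⟨q', hq'1, hq'2, hq'3, hclose'⟩ :=
    D.exists_fixed_of_stay hτ (hqF.2.1.trans hqy) hyx hstay
  have hq'F : q' ∈ F := ⟨hq'1, hq'2, hq'3⟩
  obtain ⟨m, htm, hm⟩ := hclose' (ε / 2) (half_pos hε)
  have hchain₂ := (WeightedChain.orbit hα hτ.le (half_pos hε) y m).change_last hδ hm.le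
    (by linarith)
  rw [add_halves] at hchain₂
  have hint : orbitIntegral φ α y ((m + 1 : ℕ) * τ) + α (φ ((m + 1 : ℕ) * τ) y) q' =
      orbitIntegral φ α y t - D.pot (φ t y) + D.pot q' := by
    have e1 := orbitIntegral_add (φ := φ) hα y ht (sub_nonneg.2 htm)
    have e2 := D.orbitIntegral_eq_of_mem hα (x := φ t y) (sub_nonneg.2 htm) fun u hu => by
      rw [← φ.map_add]
      exact hstay _ (by linarith [hu.1])
    have e3 := D.pot_sub _ (hstay _ htm) q' (subset_closure (D.fixed_mem q' hq'1))
      (hm.trans_le (by linarith))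
    rw [← φ.map_add, sub_add_cancel] at e2
    rw [add_sub_cancel] at e1
    linarith
  obtain ⟨L, hL⟩ := WeightedChain.exists_of_transGen (stepIntegral φ α τ) (hq'3 ε hε)
  have huniq := WeightedChain.unique_of_bounded hB (((hW q hqF).trans hchain₁).trans hchain₂)
    (hW q' hq'F) hL
  have hle := hmax q' hq'F
  have hg := D.gain_pos
  linarith

end FixedPointNhd

theorem hasLargeChains_of_not_gradientLike [CompactSpace X] {φ : Flow ℝ X} {α : X → X → ℝ}
    (hα : IsAlphaFlow φ α) (h : ¬ GradientLike φ) {s : ℕ → ℝ}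
    (U : (i : ℕ) → BallCovering α (s i)) : HasLargeChains φ U := by
  intro M _ T hT i
  by_contra! hM
  refine h ?_
  rcases isEmpty_or_nonempty X with hX | hX
  · exact ⟨fun _ => 0, continuousOn_const, fun x => hX.elim x⟩
  obtain ⟨D⟩ := hα.exists_fixedPointNhd
  obtain ⟨ε, hε, hU⟩ := (U i).exists_lebesgue
  refine gradientLike_of_not_chainRecurrent (τ := T) fun x hx => ?_
  have := D.not_chainsTo_self_of_bounded (M := M) hα.1 hT hε (fun a b J hJ => ?_) hx
  · unfold ChainsTo at this
    push Not at this
    exact this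
  · obtain ⟨c, rfl⟩ := hJ.exists_chain hU
    exact (hM c).le

/-! ### Bounded chain integrals in gradient-like flows -/

/-- Below every value of `g`, at distance at most `e`, there is one of finitely many levels, which
avoid a given finite set (the values at the fixed points, when `g` is a Lyapunov function). -/
theorem exists_levels [CompactSpace X] {g : X → ℝ} (hg : Continuous g) {C : Set ℝ} (hC : C.Finite)
    {e : ℝ} (he : 0 < e) :
    ∃ L : Finset ℝ, (∀ l ∈ L, l ∉ C) ∧ ∀ x, ∃ l ∈ L, g x - e ≤ l ∧ l < g x := by
  classical
  have h : ∀ x, ∃ l, l ∈ Ioo (g x - e) (g x) ∧ l ∉ C := fun x =>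
    (Ioo_infinite (by linarith)).exists_notMem_finite hC
  choose l hl hlC using h
  obtain ⟨t, -, ht⟩ := isCompact_univ.elim_nhds_subcover
    (fun x => {z | l x < g z} ∩ {z | g z < l x + e}) fun x _ =>
      ((isOpen_lt continuous_const hg).inter (isOpen_lt hg continuous_const)).mem_nhds
        ⟨(hl x).2, show g x < l x + e by linarith [(hl x).1]⟩
  refine ⟨t.image l, fun r hr => ?_, fun x => ?_⟩
  · obtain ⟨x, -, rfl⟩ := Finset.mem_image.1 hr
    exact hlC x
  · obtain ⟨y, hy, hxy⟩ := mem_iUnion₂.1 (ht (mem_univ x))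
    refine ⟨l y, Finset.mem_image_of_mem _ hy, ?_, hxy.1⟩
    have : g x < l y + e := hxy.2
    linarith

/-- In a gradient-like flow a bounded counting function decreases along trajectories of time length
at least `1` followed by small jumps, by at least `1` if the trajectory starts outside of a given
neighbourhood of the fixed points. -/
theorem exists_counting_function [CompactSpace X] {φ : Flow ℝ X}
    (hfin : {p | IsFixedPoint φ p}.Finite) (h : GradientLike φ) {V : Set X} (hV : IsOpen V)
    (hVf : ∀ p, IsFixedPoint φ p → p ∈ V) :
    ∃ (G : X → ℕ) (K : ℕ) (σ : ℝ), 0 < σ ∧ (∀ x, G x ≤ K) ∧ ∀ (x y : X) (t : ℝ), 1 ≤ t →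
      dist (φ t x) y < σ → G y ≤ G x ∧ (x ∉ V → G y + 1 ≤ G x) := by
  classical
  obtain ⟨g, hgc, hgd⟩ := h
  have hg : Continuous g := continuousOn_univ.1 hgc
  have hlt : ∀ x t, 0 < t → ¬ IsFixedPoint φ x → g (φ t x) < g x := fun x t ht hx =>
    hgd x t ht hx fun _ _ => mem_univ _
  have hle : ∀ x t, 0 ≤ t → g (φ t x) ≤ g x := by
    intro x t ht
    by_cases hx : IsFixedPoint φ x
    · rw [hx t]
    · rcases ht.eq_or_lt with rfl | ht
      · rw [φ.map_zero_apply]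
      · exact (hlt x t ht hx).le
  have hg1 : Continuous fun x => g (φ 1 x) := hg.comp (φ.continuous_toFun 1)
  obtain ⟨e, he, hdrop⟩ := (hV.isClosed_compl.isCompact).exists_forall_le'
    (f := fun x => g x - g (φ 1 x)) (hg.sub hg1).continuousOn (a := 0)
    fun x hx => sub_pos.2 (hlt x 1 one_pos fun hf => hx (hVf x hf))
  obtain ⟨L, hLC, hL⟩ := exists_levels hg (hfin.image g) (half_pos he)
  -- A trajectory of time length `1` that starts at or below a level ends definitely below it.
  have hmargin : ∀ l ∈ L, ∀ᶠ η in 𝓝[>] (0 : ℝ), ∀ x, g x ≤ l → g (φ 1 x) + η ≤ l := by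
    intro l hl
    obtain ⟨a, ha, hax⟩ := ((isClosed_le hg continuous_const).isCompact :
      IsCompact {x | g x ≤ l}).exists_forall_le' (f := fun x => l - g (φ 1 x))
      (continuous_const.sub hg1).continuousOn (a := 0) fun x hx => by
        rw [sub_pos]
        by_cases hf : IsFixedPoint φ x
        · rw [hf 1]
          exact lt_of_le_of_ne hx fun h => hLC l hl ⟨x, hf, h⟩
        · exact (hlt x 1 one_pos hf).trans_le hx
    filter_upwards [nhdsWithin_le_nhds (gt_mem_nhds ha)] with η hη x hx
    linarith [hax x hx]
  obtain ⟨η, ⟨hη, hηe⟩, hη0⟩ := ((((Finset.eventually_all L).2 hmargin).and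
    (nhdsWithin_le_nhds (gt_mem_nhds (half_pos he)))).and self_mem_nhdsWithin).exists
  obtain ⟨σ, hσ, hunif⟩ := Metric.uniformContinuous_iff.1
    (CompactSpace.uniformContinuous_of_continuous hg) η hη0
  refine ⟨fun x => (L.filter fun l => l < g x).card, L.card, σ, hσ,
    fun x => Finset.card_filter_le _ _, fun x y t ht hxy => ?_⟩
  have hy : g y ≤ g (φ 1 x) + η := by
    have h1 := (abs_lt.1 (hunif hxy)).1
    have h2 := hle (φ 1 x) (t - 1) (by linarith)
    rw [← φ.map_add, sub_add_cancel] at h2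
    linarith
  have hsub : (L.filter fun l => l < g y) ⊆ L.filter fun l => l < g x := by
    intro l hl
    rw [Finset.mem_filter] at hl ⊢
    refine ⟨hl.1, ?_⟩
    by_contra! hx
    linarith [hη l hl.1 x hx]
  refine ⟨Finset.card_le_card hsub, fun hx => Finset.card_lt_card ?_⟩
  obtain ⟨l, hl, hl1, hl2⟩ := hL x
  refine (Finset.ssubset_iff_of_subset hsub).2 ⟨l, Finset.mem_filter.2 ⟨hl, hl2⟩, fun hly => ?_⟩
  have := hdrop x hx
  linarith [(Finset.mem_filter.1 hly).2]

theorem sum_succ_sub_castSucc (n : ℕ) (f : Fin (n + 1) → ℝ) :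
    ∑ j : Fin n, (f j.succ - f j.castSucc) = f (Fin.last n) - f 0 := by
  have h := (Fin.sum_univ_succ f).symm.trans (Fin.sum_univ_castSucc f)
  rw [Finset.sum_sub_distrib]
  linarith

/-- A jump within a small ball of a coherent covering near the fixed points changes the primitive of
the covering by as much as the primitive near the fixed points. -/
theorem FixedPointNhd.prim_sub_eq {φ : Flow ℝ X} {α : X → X → ℝ} (D : FixedPointNhd φ α) {s : ℝ}
    {U : BallCovering α s} (hU : U.IsCoherent) {κ : ℝ} (hsκ : 2 * s < κ) (hsδ : 2 * s < D.δ)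
    {j : Fin U.card} {z y : X} (hz : z ∈ ball (U.center j) s) (hy : y ∈ ball (U.center j) s)
    (hN : ball z κ ⊆ D.N) : U.prim j y - U.prim j z = D.pot y - D.pot z := by
  have hsub : closure (ball (U.center j) s) ⊆ closure D.N := by
    intro w hw
    refine subset_closure (hN ?_)
    have h1 := closure_ball_subset_closedBall hw
    rw [mem_closedBall] at h1
    rw [mem_ball'] at hz
    rw [mem_ball]
    linarith [dist_triangle w (U.center j) z]
  have hzS := subset_closure hz
  have hyS := subset_closure hy
  rcases hU j with hcon | hα
  · have key : U.prim j z - D.pot z = U.prim j y - D.pot y := by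
      refine hcon.induction₂ (fun u v => U.prim j u - D.pot u = U.prim j v - D.pot v) ?_
        (fun _ _ _ _ _ _ h1 h2 => h1.trans h2) (fun _ _ _ _ h => h.symm) hzS hyS
      intro u hu
      have ht : Tendsto (fun v => (u, v)) (𝓝[closure (ball (U.center j) s)] u)
          (𝓝[closure (ball (U.center j) s) ×ˢ closure (ball (U.center j) s)] (u, u)) := by
        refine tendsto_nhdsWithin_iff.2 ⟨?_, ?_⟩
        · exact ((continuous_const.prodMk continuous_id).tendsto u).mono_left nhdsWithin_le_nhds
        · filter_upwards [self_mem_nhdsWithin] with v hv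
          exact ⟨hu, hv⟩
      filter_upwards [ht.eventually ((U.isPrimitiveOn j).2 u hu), self_mem_nhdsWithin,
        nhdsWithin_le_nhds (ball_mem_nhds u D.δ_pos)] with v h1 hv h2
      have h3 := D.pot_sub u (hsub hu) v (hsub hv) (by rwa [dist_comm])
      linarith
    linarith
  · rw [hα z hzS y hyS, D.pot_sub z (hsub hzS) y (hsub hyS)]
    rw [mem_ball] at hz
    rw [mem_ball'] at hy
    linarith [dist_triangle z (U.center j) y]

/-- In a gradient-like flow the increments of the primitive near the fixed points account for the
integral along a chain, up to boundedly many trajectories of time length between `1` and `2` that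
start away from the fixed points. -/
theorem not_hasLargeChains_of_gradientLike [CompactSpace X] {φ : Flow ℝ X} {α : X → X → ℝ}
    (hα : IsCocycle α) (D : FixedPointNhd φ α) (h : GradientLike φ) {s : ℕ → ℝ}
    (hs : Tendsto s atTop (𝓝 0)) (U : (i : ℕ) → BallCovering α (s i))
    (hU : ∀ i, (U i).IsCoherent) : ¬ HasLargeChains φ U := by
  classical
  intro hlarge
  -- Points of `V` stay in `N` for two units of time, together with the `κ`-balls about them.
  obtain ⟨R, hR, hRN⟩ := D.fixed_finite.isCompact.exists_thickening_subset_open D.isOpen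
    (fun p hp => D.fixed_mem p hp)
  obtain ⟨r, hr, hflow⟩ := exists_dist_flow_lt φ 2 (half_pos hR)
  set V := thickening r {p | IsFixedPoint φ p} with hVdef
  set κ := R / 2 with hκdef
  have hκ : 0 < κ := half_pos hR
  have hV : ∀ x ∈ V, ∀ t ∈ Icc (0 : ℝ) 2, ball (φ t x) κ ⊆ D.N := by
    intro x hx t ht w hw
    obtain ⟨p, hp, hxp⟩ := mem_thickening_iff.1 hx
    have h1 := hflow x p hxp t ht
    rw [hp t] at h1
    rw [mem_ball] at hw
    exact hRN (mem_thickening_iff.2 ⟨p, hp, by linarith [dist_triangle w (φ t x) p]⟩)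
  obtain ⟨G, K, σ, hσ, hGK, hG⟩ := exists_counting_function D.fixed_finite h
    (V := V) isOpen_thickening fun p hp => self_subset_thickening hr _ hp
  obtain ⟨i, hi⟩ := (hs.eventually (gt_mem_nhds (show 0 < min κ (min σ D.δ) / 2 from
    half_pos (lt_min hκ (lt_min hσ D.δ_pos))))).exists
  have hsκ : 2 * s i < κ := by linarith [min_le_left κ (min σ D.δ)]
  have hsσ : 2 * s i < σ := by
    linarith [(min_le_right κ (min σ D.δ)).trans (min_le_left σ D.δ)]
  have hsδ : 2 * s i < D.δ := by
    linarith [(min_le_right κ (min σ D.δ)).trans (min_le_right σ D.δ)]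
  obtain ⟨C, hC⟩ := exists_abs_orbitIntegral_le φ hα 2
  have hC' : ∃ C', 0 ≤ C' ∧ ∀ j, ∀ x ∈ ball ((U i).center j) (s i),
      ∀ y ∈ ball ((U i).center j) (s i), |(U i).prim j y - (U i).prim j x| ≤ C' := by
    choose m hm using fun j => ((U i).isPrimitiveOn j).1
    obtain ⟨m', hm'⟩ := (finite_range m).bddAbove
    refine ⟨2 * |m'|, by positivity, fun j x hx y hy => ?_⟩
    have h1 := hm j x (subset_closure hx)
    have h2 := hm j y (subset_closure hy)
    have h3 := (hm' (mem_range_self j)).trans (le_abs_self m')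
    linarith [abs_sub ((U i).prim j y) ((U i).prim j x)]
  obtain ⟨C', hC'0, hC'⟩ := hC'
  set b := (closure D.N).indicator D.pot with hb
  have hb0 : ∀ x, 0 ≤ b x := fun x => indicator_nonneg (fun x hx => D.pot_nonneg x hx) x
  have hbρ : ∀ x, b x ≤ D.ρ := by
    intro x
    by_cases hx : x ∈ closure D.N
    · rw [hb, indicator_of_mem hx]
      linarith [D.pot_le x hx, D.gain_pos]
    · rw [hb, indicator_of_notMem hx]
      exact D.ρ_pos.le
  have hC0 : ∀ x : X, 0 ≤ C := fun x => (abs_nonneg _).trans (hC x 0 le_rfl zero_le_two)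
  set E := C + C' + D.ρ with hE
  have hstep : ∀ (x y : X) (t v : ℝ), 1 ≤ t → t ≤ 2 → dist (φ t x) y < min σ κ → |v| ≤ C' →
      (ball (φ t x) κ ⊆ D.N → v = D.pot y - D.pot (φ t x)) →
      |orbitIntegral φ α x t + v - (b y - b x)| ≤ E * (G x - G y) := by
    intro x y t v ht1 ht2 hd hv hvN
    obtain ⟨hG1, hG2⟩ := hG x y t ht1 (hd.trans_le (min_le_left _ _))
    have hG1' : (G y : ℝ) ≤ G x := by exact_mod_cast hG1
    have hE0 : 0 ≤ E := by linarith [hC0 x, D.ρ_pos]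
    by_cases hx : x ∈ V
    · have hmem : ∀ u ∈ Icc (0 : ℝ) 2, φ u x ∈ closure D.N := fun u hu =>
        subset_closure (hV x hx u hu (mem_ball_self hκ))
      have h0 := D.orbitIntegral_eq_of_mem hα (x := x) (t := t) (by linarith)
        fun u hu => hmem u ⟨hu.1, hu.2.trans ht2⟩
      have hball := hV x hx t ⟨by linarith, ht2⟩
      have hyN : y ∈ closure D.N := subset_closure (hball (by
        rw [mem_ball']
        exact hd.trans_le (min_le_right _ _)))
      have hxN : x ∈ closure D.N := by
        simpa [φ.map_zero_apply] using hmem 0 ⟨le_rfl, zero_le_two⟩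
      have e : orbitIntegral φ α x t + v - (b y - b x) = 0 := by
        rw [h0, hvN hball, hb, indicator_of_mem hyN, indicator_of_mem hxN]
        ring
      rw [e, abs_zero]
      exact mul_nonneg hE0 (by linarith)
    · have hG2' : (G y : ℝ) + 1 ≤ G x := by exact_mod_cast hG2 hx
      have h1 : |orbitIntegral φ α x t + v - (b y - b x)| ≤ E := by
        have h2 := abs_le.1 (hC x t (by linarith) ht2)
        have h3 := abs_le.1 hv
        rw [abs_le]
        constructor <;> linarith [hb0 x, hb0 y, hbρ x, hbρ y, h2.1, h2.2, h3.1, h3.2]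
      nlinarith
  have hlong : ∀ (n : ℕ) (x y : X) (t v : ℝ), 1 ≤ t → t ≤ n + 2 → dist (φ t x) y < min σ κ →
      |v| ≤ C' → (ball (φ t x) κ ⊆ D.N → v = D.pot y - D.pot (φ t x)) →
      |orbitIntegral φ α x t + v - (b y - b x)| ≤ E * (G x - G y) := by
    intro n
    induction n with
    | zero => intro x y t v h1 h2; exact hstep x y t v h1 (by simpa using h2)
    | succ n ih =>
      intro x y t v h1 h2 hd hv hvN
      rcases le_or_gt t 2 with h3 | h3
      · exact hstep x y t v h1 h3 hd hv hvN
      · have e := orbitIntegral_add (φ := φ) hα x zero_le_one (sub_nonneg.2 h1)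
        rw [add_sub_cancel] at e
        have ht : φ (t - 1) (φ 1 x) = φ t x := by rw [← φ.map_add, sub_add_cancel]
        push_cast at h2
        have i1 := hstep x (φ 1 x) 1 0 le_rfl one_le_two
          (by rw [dist_self]; exact lt_min hσ hκ) (by simpa using hC'0) (fun _ => by ring)
        have i2 := ih (φ 1 x) y (t - 1) v (by linarith) (by linarith) (by rwa [ht]) hv
          (by rwa [ht])
        rw [abs_le] at i1 i2 ⊢
        constructor <;> linarith [i1.1, i1.2, i2.1, i2.2]
  obtain ⟨c, hc⟩ := hlarge (D.ρ + |E| * K + 1)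
    (by have := D.ρ_pos; positivity) 1 one_pos i
  have hj : ∀ j, |orbitIntegral φ α (c.pt j.castSucc) (c.time j) +
      ((U i).prim (c.idx j) (c.pt j.succ) -
        (U i).prim (c.idx j) (φ (c.time j) (c.pt j.castSucc))) -
      (b (c.pt j.succ) - b (c.pt j.castSucc))| ≤
      E * (G (c.pt j.castSucc) - G (c.pt j.succ)) := by
    intro j
    obtain ⟨n, hn⟩ := exists_nat_ge (c.time j)
    have hl := c.left_mem j
    have hr := c.right_mem j
    refine hlong n _ _ _ _ (c.le_time j) (by linarith) ?_ (hC' _ _ hl _ hr) fun hN =>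
      D.prim_sub_eq (hU i) hsκ hsδ hl hr hN
    rw [mem_ball] at hl
    rw [mem_ball'] at hr
    have htri := dist_triangle (φ (c.time j) (c.pt j.castSucc)) ((U i).center (c.idx j))
      (c.pt j.succ)
    exact lt_min (by linarith) (by linarith)
  have hsum := (Finset.abs_sum_le_sum_abs _ Finset.univ).trans
    (Finset.sum_le_sum fun j (_ : j ∈ Finset.univ) => hj j)
  have t1 := sum_succ_sub_castSucc c.len fun j => b (c.pt j)
  have t2 := sum_succ_sub_castSucc c.len fun j => (G (c.pt j) : ℝ)
  have e1 : ∑ j, (orbitIntegral φ α (c.pt j.castSucc) (c.time j) +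
      ((U i).prim (c.idx j) (c.pt j.succ) -
        (U i).prim (c.idx j) (φ (c.time j) (c.pt j.castSucc))) -
      (b (c.pt j.succ) - b (c.pt j.castSucc))) =
      c.integral - (b (c.pt (Fin.last _)) - b (c.pt 0)) := by
    rw [Finset.sum_sub_distrib, t1, Finset.sum_add_distrib]
    rfl
  have e2 : ∑ j, E * ((G (c.pt (Fin.castSucc j)) : ℝ) - G (c.pt j.succ)) =
      E * (G (c.pt 0) - G (c.pt (Fin.last _))) := by
    rw [← Finset.mul_sum]
    congr 1
    rw [← neg_sub, ← t2, ← Finset.sum_neg_distrib]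
    exact Finset.sum_congr rfl fun j _ => by ring
  rw [e1, e2] at hsum
  have hGd : E * ((G (c.pt 0) : ℝ) - G (c.pt (Fin.last _))) ≤ |E| * K := by
    refine (le_abs_self _).trans ?_
    rw [abs_mul]
    refine mul_le_mul_of_nonneg_left ?_ (abs_nonneg _)
    have h1 : (G (c.pt 0) : ℝ) ≤ K := by exact_mod_cast hGK _
    have h2 : (G (c.pt (Fin.last _)) : ℝ) ≤ K := by exact_mod_cast hGK _
    rw [abs_le]
    constructor <;> linarith [(Nat.cast_nonneg _ : (0 : ℝ) ≤ G (c.pt 0)),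
      (Nat.cast_nonneg _ : (0 : ℝ) ≤ G (c.pt (Fin.last _)))]
  have hfin : |c.integral| ≤ D.ρ + |E| * K := by
    have := abs_le.1 (hsum.trans hGd)
    rw [abs_le]
    constructor <;> linarith [hb0 (c.pt 0), hbρ (c.pt 0), hb0 (c.pt (Fin.last _)),
      hbρ (c.pt (Fin.last _)), this.1, this.2]
  linarith

/-! ### Coherent coverings, unbounded trajectories, cycles of orbits -/

theorem exists_coherent_ballCovering [CompactSpace X] {α : X → X → ℝ} (hα : IsCocycle α)
    {δ s : ℝ} (hδ : IsCocycleScale α δ) (hs : 0 < s) (hsδ : s < δ) :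
    ∃ U : BallCovering α s, U.IsCoherent := by
  obtain ⟨t, ht⟩ := isCompact_univ.elim_nhds_subcover (fun x : X => ball x s)
    fun x _ => ball_mem_nhds x hs
  have hsub : ∀ c : X, closure (ball c s) ⊆ ball c δ := fun c =>
    closure_ball_subset_closedBall.trans (closedBall_subset_ball hsδ)
  refine ⟨⟨t.card, fun j => t.equivFin.symm j, fun x => ?_, fun j => α (t.equivFin.symm j),
    fun j => hα.isPrimitiveOn_of_subset_ball hδ (hsub _)⟩, fun j => .inr fun x hx y hy => ?_⟩
  · obtain ⟨c, hc, hxc⟩ := mem_iUnion₂.1 (ht.2 (mem_univ x))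
    exact ⟨t.equivFin ⟨c, hc⟩, by simpa using hxc⟩
  · have := hδ.2 _ _ (mem_ball_self hδ.1) x (hsub _ hx) y (hsub _ hy)
    exact sub_eq_iff_eq_add'.2 this

theorem exists_coherent_sequence [CompactSpace X] {α : X → X → ℝ} (hα : IsCocycle α) :
    ∃ s : ℕ → ℝ, (∀ i, 0 < s i) ∧ Tendsto s atTop (𝓝 0) ∧
      ∃ U : (i : ℕ) → BallCovering α (s i), ∀ i, (U i).IsCoherent := by
  obtain ⟨δ, hδ⟩ := hα.exists_uniform
  have hδ0 := hδ.1
  have hpos : ∀ i : ℕ, 0 < δ / 2 * (1 / ((i : ℝ) + 1)) := fun i => by positivity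
  have hlt : ∀ i : ℕ, δ / 2 * (1 / ((i : ℝ) + 1)) < δ := by
    intro i
    have h1 : 1 / ((i : ℝ) + 1) ≤ 1 := by
      rw [div_le_one (by positivity)]
      linarith [(Nat.cast_nonneg i : (0 : ℝ) ≤ i)]
    nlinarith
  choose U hU using fun i => exists_coherent_ballCovering hα hδ (hpos i) (hlt i)
  refine ⟨_, hpos, ?_, U, hU⟩
  simpa using (tendsto_one_div_add_atTop_nhds_zero_nat (𝕜 := ℝ)).const_mul (δ / 2)

/-- A long trajectory is a chain without jumps. -/
theorem hasLargeChains_of_trajectories [CompactSpace X] {φ : Flow ℝ X} {α : X → X → ℝ}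
    (hα : IsCocycle α)
    (h : ∀ M : ℝ, 0 < M → ∃ (x : X) (T : ℝ), 0 ≤ T ∧ M ≤ |orbitIntegral φ α x T|)
    {s : ℕ → ℝ} (U : (i : ℕ) → BallCovering α (s i)) : HasLargeChains φ U := by
  intro M hM T hT i
  obtain ⟨C, hC⟩ := exists_abs_orbitIntegral_le φ hα T
  obtain ⟨x, t, ht, hx⟩ := h (max M (C + 1)) (lt_max_of_lt_left hM)
  have hTt : T ≤ t := by
    by_contra! hlt
    linarith [hC x t ht hlt.le, le_max_right M (C + 1)]
  obtain ⟨j, hj⟩ := (U i).cover (φ t x)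
  refine ⟨⟨1, one_pos, ![x, φ t x], fun _ => t, fun _ => hTt, fun _ => j, fun k => ?_,
    fun k => ?_⟩, ?_⟩
  · obtain rfl : k = 0 := Subsingleton.elim _ _
    exact hj
  · obtain rfl : k = 0 := Subsingleton.elim _ _
    exact hj
  · refine (le_max_left M (C + 1)).trans (hx.trans_eq ?_)
    simp [Chain.integral]

theorem curveIntegral_const {I : Type*} [Preorder I] (α : X → X → ℝ) (p : X) (a b : I) :
    curveIntegral α (fun _ => p) a b = 0 := by
  unfold curveIntegral
  split_ifs with h
  · obtain ⟨n, t, c, R, β, -, -, -, hJ⟩ := h.choose_spec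
    rw [hJ]
    simp
  · rfl

/-- A cycle of orbits in a gradient-like flow consists of fixed points. -/
theorem OrbitCycle.integral_eq_zero {φ : Flow ℝ X} (c : OrbitCycle φ) (α : X → X → ℝ)
    (h : GradientLike φ) : c.integral α = 0 := by
  obtain ⟨g, hgc, hgd⟩ := h
  have hg : Continuous g := continuousOn_univ.1 hgc
  have hfix : ∀ j < c.len, IsFixedPoint φ (c.x j) → c.p j = c.x j ∧ c.p (j + 1) = c.x j := by
    intro j hj hf
    have h1 := c.tendsto_atBot j hj
    have h2 := c.tendsto_atTop j hj
    simp only [hf _] at h1 h2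
    exact ⟨tendsto_nhds_unique h1 tendsto_const_nhds, tendsto_nhds_unique h2 tendsto_const_nhds⟩
  have hlt : ∀ j < c.len, ¬ IsFixedPoint φ (c.x j) → g (c.p (j + 1)) < g (c.p j) := by
    intro j hj hf
    have hmono : ∀ s t, s < t → g (φ t (c.x j)) < g (φ s (c.x j)) := by
      intro s t hst
      have := hgd (φ s (c.x j)) (t - s) (sub_pos.2 hst) (not_isFixedPoint_flow hf s)
        fun _ _ => mem_univ _
      rwa [← φ.map_add, sub_add_cancel] at this
    have h1 : g (φ 0 (c.x j)) ≤ g (c.p j) := by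
      refine ge_of_tendsto ((hg.tendsto _).comp (c.tendsto_atBot j hj)) ?_
      filter_upwards [eventually_lt_atBot 0] with t ht
      exact (hmono t 0 ht).le
    have h2 : g (c.p (j + 1)) ≤ g (φ 1 (c.x j)) := by
      refine le_of_tendsto ((hg.tendsto _).comp (c.tendsto_atTop j hj)) ?_
      filter_upwards [eventually_gt_atTop 1] with t ht
      exact (hmono 1 t ht).le
    linarith [hmono 0 1 one_pos]
  have hnn : ∀ j ∈ Finset.range c.len, 0 ≤ g (c.p j) - g (c.p (j + 1)) := by
    intro j hj
    rw [Finset.mem_range] at hj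
    by_cases hf : IsFixedPoint φ (c.x j)
    · rw [(hfix j hj hf).1, (hfix j hj hf).2, sub_self]
    · linarith [hlt j hj hf]
  have hsum : ∑ j ∈ Finset.range c.len, (g (c.p j) - g (c.p (j + 1))) = 0 := by
    rw [Finset.sum_range_sub' (fun j => g (c.p j)), c.closed, sub_self]
  have hzero := (Finset.sum_eq_zero_iff_of_nonneg hnn).1 hsum
  refine Finset.sum_eq_zero fun j hj => ?_
  have hj' := Finset.mem_range.1 hj
  have hf : IsFixedPoint φ (c.x j) := by
    by_contra hf
    linarith [hlt j hj' hf, hzero j hj]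
  have hconst : completedOrbit φ (c.x j) (c.p j) (c.p (j + 1)) = fun _ => c.x j := by
    funext t
    unfold completedOrbit
    rw [(hfix j hj' hf).1, (hfix j hj' hf).2, hf]
    simp
  rw [hconst]
  exact curveIntegral_const α _ _ _

end CocycleFlow

theorem theorem3p4p3 {X : Type*} [MetricSpace X] [CompactSpace X] (φ : Flow ℝ X)
    (α : X → X → ℝ) (hα : IsAlphaFlow φ α) (hnt : ¬ IsTrivial α) :
    -- the characterization
    (¬ GradientLike φ ↔
      ∀ s : ℕ → ℝ, (∀ i, 0 < s i) → Tendsto s atTop (𝓝 0) →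
        ∀ U : (i : ℕ) → BallCovering α (s i), HasLargeChains φ U) ∧
    -- sufficiency holds already for a single sequence of coverings
    (∀ s : ℕ → ℝ, (∀ i, 0 < s i) → Tendsto s atTop (𝓝 0) →
      ∀ U : (i : ℕ) → BallCovering α (s i), (∀ i, (U i).IsCoherent) →
        HasLargeChains φ U → ¬ GradientLike φ) ∧
    -- sufficiency of trajectories with arbitrarily large integral
    ((∀ M : ℝ, 0 < M → ∃ (x : X) (T : ℝ), 0 ≤ T ∧ M ≤ |orbitIntegral φ α x T|) →
      ¬ GradientLike φ) ∧
    -- sufficiency of an oriented cycle of orbits with nonzero integral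
    ((∃ c : OrbitCycle φ, 1 ≤ |c.integral α|) → ¬ GradientLike φ) := by
  obtain ⟨D⟩ := hα.exists_fixedPointNhd
  have hb : ∀ s : ℕ → ℝ, (∀ i, 0 < s i) → Tendsto s atTop (𝓝 0) →
      ∀ U : (i : ℕ) → BallCovering α (s i), (∀ i, (U i).IsCoherent) →
        HasLargeChains φ U → ¬ GradientLike φ :=
    fun s _ hs U hU hl hg => not_hasLargeChains_of_gradientLike hα.1 D hg hs U hU hl
  obtain ⟨s, hs0, hs, U, hU⟩ := exists_coherent_sequence hα.1
  refine ⟨⟨fun h s _ _ U => hasLargeChains_of_not_gradientLike hα h U,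
    fun h => hb s hs0 hs U hU (h s hs0 hs U)⟩, hb, fun h => ?_, ?_⟩
  · exact hb s hs0 hs U hU (hasLargeChains_of_trajectories hα.1 h U)
  · rintro ⟨c, hc⟩ hg
    rw [c.integral_eq_zero α hg, abs_zero] at hc
    linarith
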